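/- **Setting.** Consider a two-player zero-sum stochastic game on a finite state space $S\cup\{0\}$ with finite nonempty action sets $A_1(i), A_2(i)$, transition probabilities $P_{ij}(u,v)$ and real costs $c(i,u,v)$; player 1 minimizes and player 2 maximizes the cumulative cost. The game is alternating: $S=S_1\sqcup S_2$, $|A_2(i)|=1$ for $i\in S_1$, $|A_1(i)|=1$ for $i\in S_2$, and $P_{ij}(u,v)=0$ whenever $i,j$ are both in $S_1$ or both in $S_2$. Write $a=(u,v)$ for a combined action at $i$, and call a map $\pi$ that assigns a combined action to every state a (combined stationary) policy; $X^\pi$ is the Markov chain it induces. For stationary policies $\mu,\nu$ of the two players let $J^{\mu,\nu}(i)=\mathbb E\big[\sum_{k\ge 0}c(X_k,\mu(X_k),\nu(X_k))\,\big|\,X_0=i\big]$. Let $p$ be a distribution of initial states, and assume: 1. for every policy $\pi$ and every state $i$, the chain $X^\pi$ with $X_0\sim p$ reaches $i$ with positive probability; 2. for all states $i,j$ and combined actions $a,b$ at $i$, $P_{ij}(a)>0$ if and only if $P_{ij}(b)>0$; 3. state $0$ is absorbing and has cost $0$ under every action, and the directed graph on $S$ with an edge $i\to j$ whenever $P_{ij}(a)>0$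 for some $a$ is acyclic (no self-loops either), so $0$ is the only absorbing state. Put $c'(i,a)=c(i,a)$ for $i\notin S_2$ and $c'(i,a)=-c(i,a)$ for $i\in S_2$, and let $(T'J)(i)=\min_a\big[c'(i,a)-\sum_j P_{ij}(a)J(j)\big]$ be the negamin Bellman operator. **Algorithm.** Let $\beta:\mathbb N\to[0,\infty)$ with $\sum_t\beta(t)=\infty$ and $\sum_t\beta(t)^2<\infty$. Start from a deterministic vector $J_0$ (for instance $J_0=0$). At iteration $t$, let $\pi_t$ be a greedy policy, i.e. $\pi_t(i)$ minimizes $c'(i,a)-\sum_jP_{ij}(a)J_t(j)$ over $a$ for every $i$, ties being broken in any non-anticipating way; given the past, simulate a trajectory $X^{(t)}$ of the Markov chain $X^{\pi_t}$ with initial distribution $p$. For every state $i$ visited by $X^{(t)}$, with first visit time $N_t(i)$, set $$J_{t+1}(i)=(1-\gamma_t(i))J_t(i)+\gamma_t(i)\sum_{k\ge N_t(i)}(-1)^{k-N_t(i)}c'\big(X^{(t)}_k,\pi_t(X^{(t)}_k)\big),$$ and set $J_{t+1}(i)=J_t(i)$ for every other state. The step size is either $\gamma_t(i)=\beta(t)$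 for all $t,i$, or $\gamma_t(i)=\beta(n_t(i))$ for all $t,i$, where $n_t(i)$ is the number of iterations $\tau<t$ whose trajectory visits $i$. **Theorem (Alternating Zero-Sum Game).** The game has a value $J^*$, that is, $\inf_\mu\sup_\nu J^{\mu,\nu}(i)=\sup_\nu\inf_\mu J^{\mu,\nu}(i)=J^*(i)$ for every state $i$, and it satisfies the minimax Bellman equation $J^*(i)=\min_u\max_v\big[c(i,u,v)+\sum_jP_{ij}(u,v)J^*(j)\big]$. The function $J'(i)=J^*(i)$ for $i\notin S_2$, $J'(i)=-J^*(i)$ for $i\in S_2$, is the unique solution of $T'J'=J'$. With either step-size rule, almost surely $J_t(i)\to J'(i)$ for every state $i$; and $J^*$ is recovered from $J'$ by the same change of sign on $S_2$, so that, after this change of sign, $J_t$ converges almost surely to $J^*$. -/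

import Mathlib

open MeasureTheory ProbabilityTheory Filter Topology

universe u v z

noncomputable section

/-- A two-player zero-sum stochastic game on the state set `S`, with a distinguished state `zero`
and, in every state, finite nonempty action sets for the two players. Player 1 minimizes and
player 2 maximizes the cumulative cost. -/
structure StochasticGame (S : Type u) where
  A₁ : S → Type v
  A₂ : S → Type v
  finite₁ : ∀ i, Finite (A₁ i)
  finite₂ : ∀ i, Finite (A₂ i)
  nonempty₁ : ∀ i, Nonempty (A₁ i)
  nonempty₂ : ∀ i, Nonempty (A₂ i)
  /-- `P i u v j` is the probability of moving from `i` to `j` under the action pair `(u, v)`. -/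
  P : ∀ i, A₁ i → A₂ i → PMF S
  c : ∀ i, A₁ i → A₂ i → ℝ
  zero : S

attribute [instance] StochasticGame.finite₁ StochasticGame.finite₂
  StochasticGame.nonempty₁ StochasticGame.nonempty₂

/-- An alternating game: the states other than `zero` are partitioned into the set `S₁` where
player 1 moves and the set `S₂` where player 2 moves; the other player has a single action there,
and no player moves twice in a row. -/
structure AlternatingGame (S : Type u) extends StochasticGame.{u, v} S where
  S₁ : Set S
  S₂ : Set S
  disjoint : Disjoint S₁ S₂
  cover : S₁ ∪ S₂ = {zero}ᶜ
  trivial₂ : ∀ i ∈ S₁, Subsingleton (A₂ i)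
  trivial₁ : ∀ i ∈ S₂, Subsingleton (A₁ i)
  alternate : ∀ i j u v, (i ∈ S₁ ∧ j ∈ S₁) ∨ (i ∈ S₂ ∧ j ∈ S₂) → P i u v j = 0

namespace StochasticGame

variable {S : Type u}

/-- Stationary policies that choose the combined action `(u, v)` in every state. -/
abbrev JointPolicy (G : StochasticGame.{u, v} S) := ∀ i, G.A₁ i × G.A₂ i

/-- The combined policy of a policy `μ` of player 1 and a policy `ν` of player 2. -/
def joint (G : StochasticGame.{u, v} S) (μ : ∀ i, G.A₁ i) (ν : ∀ i, G.A₂ i) :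
    G.JointPolicy := fun i => (μ i, ν i)

section Chain

variable [Finite S] [MeasurableSpace S] [DiscreteMeasurableSpace S]

/-- The transition kernel of the Markov chain `X^π`. -/
def stepKernel (G : StochasticGame.{u, v} S) (π : G.JointPolicy) : Kernel S S :=
  Kernel.ofFunOfCountable fun i => (G.P i (π i).1 (π i).2).toMeasure

instance (G : StochasticGame.{u, v} S) (π : G.JointPolicy) :
    IsMarkovKernel (G.stepKernel π) :=
  ⟨fun i => PMF.toMeasure.isProbabilityMeasure (G.P i (π i).1 (π i).2)⟩

/-- The same transition kernel, as a function of the history up to time `n`: only the last state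
matters. -/
def histKernel (G : StochasticGame.{u, v} S) (π : G.JointPolicy) (n : ℕ) :
    Kernel (∀ _ : Finset.Iic n, S) S :=
  (G.stepKernel π).comap (fun h => h ⟨n, Finset.mem_Iic.2 le_rfl⟩) (measurable_pi_apply _)

instance (G : StochasticGame.{u, v} S) (π : G.JointPolicy) (n : ℕ) :
    IsMarkovKernel (G.histKernel π n) :=
  inferInstanceAs (IsMarkovKernel ((G.stepKernel π).comap _ _))

/-- The law, on the space of trajectories, of the Markov chain `X^π` with initial
distribution `p`. -/
def chainLaw (G : StochasticGame.{u, v} S) (p : PMF S) (π : G.JointPolicy) :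
    Measure (ℕ → S) :=
  Kernel.trajMeasure (X := fun _ => S) p.toMeasure (G.histKernel π)

/-- `q_π(i)`: the probability that the chain with initial distribution `p` ever reaches `i`. -/
def reachProb (G : StochasticGame.{u, v} S) (p : PMF S) (π : G.JointPolicy) (i : S) : ℝ :=
  (G.chainLaw p π).real {x | ∃ k, x k = i}

/-- `J^{μ,ν}(i)`: the expected cumulative cost of the game started in `i`. -/
def cost (G : StochasticGame.{u, v} S) (μ : ∀ i, G.A₁ i) (ν : ∀ i, G.A₂ i) (i : S) : ℝ :=
  ∫ x, ∑' k, G.c (x k) (μ (x k)) (ν (x k)) ∂(G.chainLaw (PMF.pure i) (G.joint μ ν))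

/-- `J` is the value function of the game: `inf_μ sup_ν J^{μ,ν} = sup_ν inf_μ J^{μ,ν} = J`. -/
def IsValue (G : StochasticGame.{u, v} S) (J : S → ℝ) : Prop :=
  ∀ i, (⨅ μ : ∀ i, G.A₁ i, ⨆ ν : ∀ i, G.A₂ i, G.cost μ ν i) = J i ∧
    (⨆ ν : ∀ i, G.A₂ i, ⨅ μ : ∀ i, G.A₁ i, G.cost μ ν i) = J i

/-- Every state is reached with positive probability under every policy. -/
def Reachable (G : StochasticGame.{u, v} S) (p : PMF S) : Prop :=
  ∀ (π : G.JointPolicy) (i : S), 0 < G.reachProb p π i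

end Chain

/-- The possible one-step transitions do not depend on the actions. -/
def CommonTransitions (G : StochasticGame.{u, v} S) : Prop :=
  ∀ (i j : S) (a b : G.A₁ i × G.A₂ i), 0 < G.P i a.1 a.2 j ↔ 0 < G.P i b.1 b.2 j

/-- The edges of the reachability graph between states other than `zero`. -/
def Edge (G : StochasticGame.{u, v} S) (i j : S) : Prop :=
  i ≠ G.zero ∧ j ≠ G.zero ∧ ∃ a : G.A₁ i × G.A₂ i, 0 < G.P i a.1 a.2 j

/-- The structural assumption of shortest path problems: `zero` is absorbing and free of cost, and
the reachability graph on the other states has no directed cycle. Self-loops are cycles, so `zero`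
is the only absorbing state. -/
structure IsShortestPath (G : StochasticGame.{u, v} S) : Prop where
  absorbing : ∀ a b, G.P G.zero a b G.zero = 1
  cost_zero : ∀ a b, G.c G.zero a b = 0
  acyclic : ∀ i, ¬ Relation.TransGen G.Edge i i

/-- The minimax Bellman operator `T`. -/
def minimaxOp [Fintype S] (G : StochasticGame.{u, v} S) (J : S → ℝ) (i : S) : ℝ :=
  ⨅ u : G.A₁ i, ⨆ v : G.A₂ i, (G.c i u v + ∑ j, (G.P i u v j).toReal * J j)

end StochasticGame

/-- The two choices of the step size: `β(t)` and `β(n_t(i))`. -/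
inductive StepRule
  | time
  | visits

open Classical in
/-- The step size `γ_t(i)`, where `x τ` is the trajectory of iteration `τ` and `n_t(i)` is the
number of iterations before `t` whose trajectory visits `i`. -/
def stepSize {S : Type u} (β : ℕ → ℝ) (x : ℕ → ℕ → S) (t : ℕ) (i : S) : StepRule → ℝ
  | StepRule.time => β t
  | StepRule.visits => β ((Finset.range t).filter fun τ => ∃ k, x τ k = i).card

namespace AlternatingGame

variable {S : Type u}

open Classical in
/-- Change of sign at the states of player 2. It maps `J*` to `J'` and `J'` to `J*`. -/
def flip (G : AlternatingGame.{u, v} S) (J : S → ℝ) (i : S) : ℝ :=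
  if i ∈ G.S₂ then -J i else J i

open Classical in
/-- The negamin cost `c'`: the cost from the perspective of the player who moves. -/
def negCost (G : AlternatingGame.{u, v} S) (i : S) (a : G.A₁ i × G.A₂ i) : ℝ :=
  if i ∈ G.S₂ then -G.c i a.1 a.2 else G.c i a.1 a.2

/-- `c'(i,a) - ∑_j P_ij(a) J(j)`. -/
def negQ [Fintype S] (G : AlternatingGame.{u, v} S) (J : S → ℝ) (i : S)
    (a : G.A₁ i × G.A₂ i) : ℝ :=
  G.negCost i a - ∑ j, (G.P i a.1 a.2 j).toReal * J j

/-- The negamin Bellman operator `T'`. -/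
def negaminOp [Fintype S] (G : AlternatingGame.{u, v} S) (J : S → ℝ) (i : S) : ℝ :=
  ⨅ a : G.A₁ i × G.A₂ i, G.negQ J i a

/-- `π` is a greedy policy for `J`: it minimizes `T'_π J` in every component. -/
def IsGreedy [Fintype S] (G : AlternatingGame.{u, v} S) (J : S → ℝ)
    (π : G.JointPolicy) : Prop :=
  ∀ i a, G.negQ J i (π i) ≤ G.negQ J i a

/-- The Monte Carlo estimate from the trajectory `x` under `π`, for a state `i` that it visits: the
tail cost from the first visit `N` of `i`, with costs `c'` and discount factor `-1`. -/
def estimate (G : AlternatingGame.{u, v} S) (x : ℕ → S) (π : G.JointPolicy) (i : S) : ℝ :=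
  ∑' k, (-1 : ℝ) ^ k *
    G.negCost (x (sInf {n | x n = i} + k)) (π (x (sInf {n | x n = i} + k)))

open Classical in
/-- The iterates `J_t` of the algorithm started in `J₀`, when iteration `t` uses the policy `π t`
and produces the trajectory `x t`. -/
def iterate (G : AlternatingGame.{u, v} S) (β : ℕ → ℝ) (rule : StepRule) (J₀ : S → ℝ)
    (x : ℕ → ℕ → S) (π : ℕ → G.JointPolicy) : ℕ → S → ℝ
  | 0 => J₀
  | t + 1 => fun i =>
      if ∃ k, x t k = i then
        (1 - stepSize β x t i rule) * iterate G β rule J₀ x π t i +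
          stepSize β x t i rule * G.estimate (x t) (π t) i
      else iterate G β rule J₀ x π t i

/-- A run of the algorithm on a probability space. `ℱ t` is the information available before the
trajectory `X t` of iteration `t` is simulated. The policy `pol t` is greedy for the current
iterate (ties may be broken in any non-anticipating way), and, given the past, `X t` is a Markov
chain that follows `pol t` from an initial state with distribution `p`. -/
structure IsRun [Fintype S] [MeasurableSpace S] [DiscreteMeasurableSpace S]
    (G : AlternatingGame.{u, v} S) (p : PMF S) (β : ℕ → ℝ) (rule : StepRule) (J₀ : S → ℝ)
    {Ω : Type z} {mΩ : MeasurableSpace Ω} (Pr : Measure Ω) (ℱ : Filtration ℕ mΩ)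
    (X : ℕ → Ω → ℕ → S) (pol : ℕ → Ω → G.JointPolicy) : Prop where
  measurable_X : ∀ t, Measurable[ℱ (t + 1)] (X t)
  measurable_pol : ∀ t π, MeasurableSet[ℱ t] {ω | pol t ω = π}
  greedy : ∀ t ω,
    G.IsGreedy (G.iterate β rule J₀ (fun s => X s ω) (fun s => pol s ω) t) (pol t ω)
  law : ∀ t (B : Set (ℕ → S)), MeasurableSet B →
    Pr⟦X t ⁻¹' B | ℱ t⟧ =ᵐ[Pr] fun ω => (G.chainLaw p (pol t ω)).real B

end AlternatingGame

end

/-!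
Since the graph of possible transitions is acyclic, functions on the states can be computed by
well-founded recursion from `zero`: this gives the cost of every policy and the unique fixed point
`J'` of the negamin operator. Play alternates between the two players, so the change of sign at the
states of player 2 turns the minimax equation into the negamin equation, and a policy that is greedy
for `J'` is a saddle point of the game.

Under a policy `π`, the Monte Carlo estimate for a visited state is the value of `π` at that state
plus a sum of martingale differences. As the squares of the step sizes are summable, the
accumulated errors converge almost surely. The probabilities with which finitely many policies
reach a state are bounded below, so almost surely the step sizes used at every state have infinite
sum. Once the iterates at all successors of a state `i` have converged to `J'`, the policy is
eventually greedy for `J'` at `i`, and by induction its values at the successors are eventually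
`J'`. Hence its value at `i` is eventually the constant `J' i`, and the iterate at `i` follows it
by stochastic approximation.
-/

noncomputable section

/-! ### Stochastic approximation -/

theorem tendsto_zero_of_le_one_sub_mul {v a : ℕ → ℝ} (hv : ∀ t, 0 ≤ v t)
    (ha : Tendsto (fun n => ∑ s ∈ Finset.range n, a s) atTop atTop)
    (h : ∀ᶠ t in atTop, v (t + 1) ≤ (1 - a t) * v t) : Tendsto v atTop (𝓝 0) := by
  obtain ⟨T, hT⟩ := eventually_atTop.1 h
  set A : ℕ → ℝ := fun n => ∑ s ∈ Finset.range n, a s with hA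
  have v_le : ∀ t ≥ T, v t ≤ Real.exp (A T - A t) * v T := by
    intro t ht
    induction t, ht using Nat.le_induction with
    | base => simp
    | succ t ht ih =>
      calc v (t + 1) ≤ (1 - a t) * v t := hT t ht
        _ ≤ Real.exp (-a t) * v t :=
          mul_le_mul_of_nonneg_right (Real.one_sub_le_exp_neg _) (hv t)
        _ ≤ Real.exp (-a t) * (Real.exp (A T - A t) * v T) :=
          mul_le_mul_of_nonneg_left ih (Real.exp_pos _).le
        _ = Real.exp (A T - A (t + 1)) * v T := by
          rw [← mul_assoc, ← Real.exp_add]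
          simp only [hA, Finset.sum_range_succ]
          ring_nf
  have exp_tendsto : Tendsto (fun t => Real.exp (A T - A t) * v T) atTop (𝓝 0) := by
    rw [← zero_mul (v T)]
    exact (Real.tendsto_exp_atBot.comp
      (tendsto_const_nhds.add_atBot (tendsto_neg_atTop_atBot.comp ha))).mul_const _
  exact tendsto_of_tendsto_of_tendsto_of_le_of_le' tendsto_const_nhds exp_tendsto
    (Eventually.of_forall hv) ((eventually_ge_atTop T).mono v_le)

theorem tendsto_zero_of_le_one_sub_mul_add {v a r : ℕ → ℝ} (hv : ∀ t, 0 ≤ v t)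
    (ha : ∀ t, 0 ≤ a t) (ha_one : ∀ᶠ t in atTop, a t ≤ 1) (hsum : ¬ Summable a)
    (hr : Tendsto r atTop (𝓝 0)) (h : ∀ᶠ t in atTop, v (t + 1) ≤ (1 - a t) * v t + a t * r t) :
    Tendsto v atTop (𝓝 0) := by
  have ha_sum := (not_summable_iff_tendsto_nat_atTop_of_nonneg ha).1 hsum
  refine tendsto_order.2 ⟨fun c hc => .of_forall fun t => hc.trans_le (hv t), fun ε hε => ?_⟩
  -- Once `r ≤ ε / 2`, the excess of `v` over `ε / 2` contracts without any perturbation.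
  have excess_tendsto : Tendsto (fun t => max (v t - ε / 2) 0) atTop (𝓝 0) := by
    refine tendsto_zero_of_le_one_sub_mul (fun t => le_max_right _ _) ha_sum ?_
    filter_upwards [h, ha_one, hr.eventually_le_const (half_pos hε)] with t hvt hat hrt
    have one_sub_nonneg : 0 ≤ 1 - a t := sub_nonneg.2 hat
    refine max_le ?_ (mul_nonneg one_sub_nonneg (le_max_right _ _))
    calc v (t + 1) - ε / 2 ≤ (1 - a t) * v t + a t * (ε / 2) - ε / 2 := by
          linarith [mul_le_mul_of_nonneg_left hrt (ha t)]
      _ = (1 - a t) * (v t - ε / 2) := by ring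
      _ ≤ (1 - a t) * max (v t - ε / 2) 0 :=
          mul_le_mul_of_nonneg_left (le_max_left _ _) one_sub_nonneg
  filter_upwards [excess_tendsto.eventually_lt_const (half_pos hε)] with t ht
  linarith [le_max_left (v t - ε / 2) 0]

theorem tendsto_of_stochasticApproximation {E : Type*} [NormedAddCommGroup E] [NormedSpace ℝ E]
    {a : ℕ → ℝ} {y d : ℕ → E} {m L : E} (ha : ∀ t, 0 ≤ a t) (ha_one : ∀ᶠ t in atTop, a t ≤ 1)
    (hsum : ¬ Summable a) (hd : Tendsto (fun n => ∑ s ∈ Finset.range n, d s) atTop (𝓝 L))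
    (hy : ∀ᶠ t in atTop, y (t + 1) = y t + a t • (m - y t) + d t) :
    Tendsto y atTop (𝓝 m) := by
  set r : ℕ → E := fun n => ∑ s ∈ Finset.range n, d s - L with hr
  have r_tendsto : Tendsto r atTop (𝓝 0) := tendsto_sub_nhds_zero_iff.2 hd
  -- Subtracting the accumulated noise leaves a contraction perturbed by `a t • r t`.
  have norm_tendsto : Tendsto (fun t => ‖y t - m - r t‖) atTop (𝓝 0) := by
    refine tendsto_zero_of_le_one_sub_mul_add (fun t => norm_nonneg _) ha ha_one hsum
      (tendsto_zero_iff_norm_tendsto_zero.1 r_tendsto) ?_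
    filter_upwards [hy, ha_one] with t hyt hat
    have recursion : y (t + 1) - m - r (t + 1) = (1 - a t) • (y t - m - r t) - a t • r t := by
      simp only [hr, hyt, Finset.sum_range_succ]
      module
    calc ‖y (t + 1) - m - r (t + 1)‖ ≤ ‖(1 - a t) • (y t - m - r t)‖ + ‖a t • r t‖ :=
          recursion ▸ norm_sub_le _ _
      _ = (1 - a t) * ‖y t - m - r t‖ + a t * ‖r t‖ := by
          rw [norm_smul_of_nonneg (sub_nonneg.2 hat), norm_smul_of_nonneg (ha t)]
  have y_eq : y = fun t => y t - m - r t + r t + m := by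
    funext t; abel
  rw [y_eq]
  simpa only [zero_add] using
    ((tendsto_zero_iff_norm_tendsto_zero.2 norm_tendsto).add r_tendsto).add_const m

/-! ### Measurability and sums of martingale differences -/

theorem measurable_apply_of_countable {α β γ δ : Type*} {_ : MeasurableSpace α}
    [Countable β] [MeasurableSpace γ] [MeasurableSpace δ] {f : α → β} {h : α → γ} {g : β → γ → δ}
    (hf : ∀ b, MeasurableSet {a | f a = b}) (hh : Measurable h) (hg : ∀ b, Measurable (g b)) :
    Measurable fun a => g (f a) (h a) := by
  let : MeasurableSpace β := ⊤
  have hf_measurable : Measurable f := measurable_to_countable' hf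
  exact (measurable_from_prod_countable_right (f := fun y => g y.1 y.2) hg).comp
    (hf_measurable.prodMk hh)

section MartingaleDifference

variable {Ω : Type*} {mΩ : MeasurableSpace Ω} {μ : Measure Ω}

theorem integral_mul_eq_zero_of_condExp_eq_zero {m : MeasurableSpace Ω} (hm : m ≤ mΩ)
    [SigmaFinite (μ.trim hm)] {f g : Ω → ℝ} (hf : StronglyMeasurable[m] f)
    (hfg : Integrable (f * g) μ) (hg : Integrable g μ) (hg_cond : μ[g | m] =ᵐ[μ] 0) :
    ∫ ω, f ω * g ω ∂μ = 0 := by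
  have hfg_cond : μ[f * g | m] =ᵐ[μ] 0 := by
    filter_upwards [condExp_mul_of_stronglyMeasurable_left hf hfg hg, hg_cond] with ω h₁ h₂
    rw [h₁, Pi.mul_apply, h₂, Pi.zero_apply, mul_zero]
  calc ∫ ω, f ω * g ω ∂μ = ∫ ω, (μ[f * g | m]) ω ∂μ := (integral_condExp hm).symm
    _ = 0 := integral_eq_zero_of_ae hfg_cond

variable [IsFiniteMeasure μ] {ℱ : Filtration ℕ mΩ} {d : ℕ → Ω → ℝ}

theorem stronglyMeasurable_sum_range (hd : ∀ n, StronglyMeasurable[ℱ (n + 1)] (d n)) (n : ℕ) :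
    StronglyMeasurable[ℱ n] (∑ s ∈ Finset.range n, d s) :=
  Finset.stronglyMeasurable_sum _ fun s hs => (hd s).mono (ℱ.mono (Finset.mem_range.1 hs))

theorem martingale_sum_range (hd : ∀ n, StronglyMeasurable[ℱ (n + 1)] (d n))
    (hint : ∀ n, Integrable (d n) μ) (hcond : ∀ n, μ[d n | ℱ n] =ᵐ[μ] 0) :
    Martingale (fun n => ∑ s ∈ Finset.range n, d s) ℱ μ :=
  martingale_of_condExp_sub_eq_zero_nat (stronglyMeasurable_sum_range hd)
    (fun n => integrable_finsetSum' _ fun s _ => hint s)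
    fun n => by simpa only [Finset.sum_range_succ_sub_sum] using hcond n

theorem integral_sq_sum_range (hd : ∀ n, StronglyMeasurable[ℱ (n + 1)] (d n))
    (hL2 : ∀ n, MemLp (d n) 2 μ) (hcond : ∀ n, μ[d n | ℱ n] =ᵐ[μ] 0) (n : ℕ) :
    ∫ ω, (∑ s ∈ Finset.range n, d s ω) ^ 2 ∂μ = ∑ s ∈ Finset.range n, ∫ ω, d s ω ^ 2 ∂μ := by
  induction n with
  | zero => simp
  | succ n ih =>
    set M : Ω → ℝ := fun ω => ∑ s ∈ Finset.range n, d s ω with hM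
    have hM_memLp : MemLp M 2 μ := memLp_finsetSum _ fun s _ => hL2 s
    have hM_meas : StronglyMeasurable[ℱ n] M := by
      simpa only [Finset.sum_fn] using stronglyMeasurable_sum_range hd n
    have cross_integrable : Integrable (M * d n) μ := hM_memLp.integrable_mul (hL2 n)
    have cross_eq_zero : ∫ ω, M ω * d n ω ∂μ = 0 :=
      integral_mul_eq_zero_of_condExp_eq_zero (ℱ.le n) hM_meas cross_integrable
        ((hL2 n).integrable one_le_two) (hcond n)
    calc ∫ ω, (∑ s ∈ Finset.range (n + 1), d s ω) ^ 2 ∂μ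
        = ∫ ω, (M ω ^ 2 + 2 * (M ω * d n ω)) + d n ω ^ 2 ∂μ :=
          integral_congr_ae <| .of_forall fun ω => by
            simp only [hM, Finset.sum_range_succ]; ring
      _ = ∫ ω, M ω ^ 2 ∂μ + 2 * ∫ ω, M ω * d n ω ∂μ + ∫ ω, d n ω ^ 2 ∂μ := by
          have cross_integrable' : Integrable (fun ω => 2 * (M ω * d n ω)) μ :=
            cross_integrable.const_mul 2
          have sum_integrable : Integrable (fun ω => M ω ^ 2 + 2 * (M ω * d n ω)) μ :=
            hM_memLp.integrable_sq.add cross_integrable'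
          rw [integral_add sum_integrable (hL2 n).integrable_sq,
            integral_add hM_memLp.integrable_sq cross_integrable', integral_const_mul]
      _ = ∑ s ∈ Finset.range (n + 1), ∫ ω, d s ω ^ 2 ∂μ := by
          rw [cross_eq_zero, ih, Finset.sum_range_succ, mul_zero, add_zero]

theorem ae_exists_tendsto_sum_of_condExp_eq_zero {B : ℝ}
    (hd : ∀ n, StronglyMeasurable[ℱ (n + 1)] (d n)) (hL2 : ∀ n, MemLp (d n) 2 μ)
    (hcond : ∀ n, μ[d n | ℱ n] =ᵐ[μ] 0) (hB : ∀ n, ∑ s ∈ Finset.range n, ∫ ω, d s ω ^ 2 ∂μ ≤ B) :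
    ∀ᵐ ω ∂μ, ∃ L, Tendsto (fun n => ∑ s ∈ Finset.range n, d s ω) atTop (𝓝 L) := by
  have hmart := martingale_sum_range hd (fun n => (hL2 n).integrable one_le_two) hcond
  have sq_integrable : ∀ n, Integrable (fun ω => (∑ s ∈ Finset.range n, d s ω) ^ 2) μ :=
    fun n => (memLp_finsetSum _ fun s _ => hL2 s).integrable_sq
  have eLpNorm_one_le : ∀ n, eLpNorm (∑ s ∈ Finset.range n, d s) 1 μ ≤
      ((μ.real Set.univ + B).toNNReal : ENNReal) := fun n => by
    rw [eLpNorm_one_eq_lintegral_enorm,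
      ← ofReal_integral_norm_eq_lintegral_enorm (hmart.integrable n)]
    refine ENNReal.ofReal_le_ofReal ?_
    calc ∫ ω, ‖(∑ s ∈ Finset.range n, d s) ω‖ ∂μ
        ≤ ∫ ω, 1 + (∑ s ∈ Finset.range n, d s ω) ^ 2 ∂μ :=
          integral_mono (hmart.integrable n).norm ((integrable_const _).add (sq_integrable n))
            fun ω => by
              simp only [Finset.sum_apply, Real.norm_eq_abs]
              nlinarith [sq_nonneg (|∑ s ∈ Finset.range n, d s ω| - 1),
                sq_abs (∑ s ∈ Finset.range n, d s ω)]
      _ = μ.real Set.univ + ∑ s ∈ Finset.range n, ∫ ω, d s ω ^ 2 ∂μ := by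
          rw [integral_add (integrable_const _) (sq_integrable n),
            integral_sq_sum_range hd hL2 hcond, integral_const, smul_eq_mul, mul_one]
      _ ≤ μ.real Set.univ + B := by gcongr; exact hB n
  filter_upwards [hmart.submartingale.exists_ae_tendsto_of_bdd eLpNorm_one_le] with ω hω
  simpa only [Finset.sum_apply] using hω

theorem ae_exists_tendsto_sum_of_condExp_eq_zero_of_sum_sq_le {d : ℕ → Ω → ℝ} {B : ℝ}
    (hd : ∀ n, StronglyMeasurable[ℱ (n + 1)] (d n)) (hcond : ∀ n, μ[d n | ℱ n] =ᵐ[μ] 0)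
    (hB : ∀ n ω, ∑ s ∈ Finset.range n, d s ω ^ 2 ≤ B) :
    ∀ᵐ ω ∂μ, ∃ L, Tendsto (fun n => ∑ s ∈ Finset.range n, d s ω) atTop (𝓝 L) := by
  have abs_le : ∀ n ω, |d n ω| ≤ √B := fun n ω => Real.abs_le_sqrt <|
    (Finset.single_le_sum (fun s _ => sq_nonneg (d s ω)) (Finset.self_mem_range_succ n)).trans
      (hB (n + 1) ω)
  have hL2 : ∀ n, MemLp (d n) 2 μ := fun n =>
    .of_bound ((hd n).mono (ℱ.le _)).aestronglyMeasurable (√B) (.of_forall (abs_le n))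
  refine ae_exists_tendsto_sum_of_condExp_eq_zero hd hL2 hcond (B := μ.real Set.univ * B)
    fun n => ?_
  rw [← integral_finsetSum _ fun s _ => (hL2 s).integrable_sq, ← smul_eq_mul,
    ← integral_const]
  exact integral_mono (integrable_finsetSum _ fun s _ => (hL2 s).integrable_sq)
    (integrable_const _) (hB n)

end MartingaleDifference

/-! ### Fixed points and saddle points -/

theorem existsUnique_fixedPoint_of_wellFounded {α β : Type*} [Nonempty β] {r : α → α → Prop}
    (hr : WellFounded r) (F : (α → β) → α → β)
    (hF : ∀ i f g, (∀ j, r j i → f j = g j) → F f i = F g i) : ∃! f, F f = f := by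
  classical
  let f : α → β := hr.fix fun i f =>
    F (fun j => if hj : r j i then f j hj else Classical.arbitrary β) i
  have hf : F f = f := funext fun i => by
    rw [show f i = _ from hr.fix_eq _ i]
    exact hF i _ _ fun j hj => by rw [dif_pos hj]
  refine ⟨f, hf, fun g hg => funext fun i => ?_⟩
  induction i using hr.induction with
  | _ i ih =>
    rw [← hg, ← hf]
    exact hF i g f ih

theorem iInf_iSup_eq_of_saddlePoint {α β : Type*} [Finite α] [Finite β] {f : α → β → ℝ} {x : ℝ}
    (a : α) (b : β) (ha : ∀ v, f a v ≤ x) (hb : ∀ u, x ≤ f u b) :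
    (⨅ u, ⨆ v, f u v) = x ∧ (⨆ v, ⨅ u, f u v) = x := by
  have : Nonempty α := ⟨a⟩
  have : Nonempty β := ⟨b⟩
  refine ⟨le_antisymm ?_ ?_, le_antisymm ?_ ?_⟩
  · exact (ciInf_le (Set.finite_range _).bddBelow a).trans (ciSup_le ha)
  · exact le_ciInf fun u => (hb u).trans (le_ciSup (f := f u) (Set.finite_range _).bddAbove b)
  · exact ciSup_le fun v =>
      (ciInf_le (f := fun u => f u v) (Set.finite_range _).bddBelow a).trans (ha v)
  · exact (le_ciInf hb).trans
      (le_ciSup (f := fun v => ⨅ u, f u v) (Set.finite_range _).bddAbove b)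

namespace StochasticGame

variable {S : Type u} {G : StochasticGame.{u, v} S} {π : G.JointPolicy} {x : ℕ → S}

/-! ### Policy evaluation in shortest path games -/

/-- `G.IsSuccessor j i`: the state `j`, which may be `zero`, can follow the state `i ≠ zero`. The
arguments are ordered such that this relation is well-founded in shortest path games. -/
def IsSuccessor (G : StochasticGame.{u, v} S) (j i : S) : Prop :=
  i ≠ G.zero ∧ ∃ a : G.A₁ i × G.A₂ i, G.P i a.1 a.2 j ≠ 0

theorem IsSuccessor.edge {i j : S} (hij : G.IsSuccessor j i) (hj : j ≠ G.zero) : G.Edge i j :=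
  ⟨hij.1, hj, hij.2.imp fun _ => pos_iff_ne_zero.2⟩

theorem IsShortestPath.wellFounded_isSuccessor [Finite S] (h : G.IsShortestPath) :
    WellFounded G.IsSuccessor := by
  have : IsTrans S fun j i => Relation.TransGen G.Edge i j := ⟨fun _ _ _ hij hjk => hjk.trans hij⟩
  have : Std.Irrefl fun j i => Relation.TransGen G.Edge i j := ⟨h.acyclic⟩
  have wellFounded_edge : WellFounded fun j i => Relation.TransGen G.Edge i j :=
    Finite.wellFounded_of_trans_of_irrefl _
  have acc_zero : Acc G.IsSuccessor G.zero := ⟨_, fun _ hj => absurd rfl hj.1⟩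
  refine ⟨fun i => wellFounded_edge.induction i fun i ih => ⟨_, fun j hj => ?_⟩⟩
  by_cases hj_zero : j = G.zero
  · exact hj_zero ▸ acc_zero
  · exact ih j (.single (hj.edge hj_zero))

theorem IsShortestPath.existsUnique_fixedPoint [Finite S] (h : G.IsShortestPath) {β : Type*}
    (c : β) (F : (S → β) → S → β)
    (hF : ∀ i ≠ G.zero, ∀ J K : S → β, (∀ j, G.IsSuccessor j i → J j = K j) → F J i = F K i) :
    ∃! J : S → β, J G.zero = c ∧ ∀ i ≠ G.zero, F J i = J i := by
  classical
  have : Nonempty β := ⟨c⟩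
  refine (existsUnique_congr fun J => ?_).1 <| existsUnique_fixedPoint_of_wellFounded
    h.wellFounded_isSuccessor (fun J i => if i = G.zero then c else F J i) fun i J K hJK => ?_
  · refine funext_iff.trans ⟨fun hJ => ⟨?_, fun i hi => ?_⟩, fun hJ i => ?_⟩
    · simpa using (hJ G.zero).symm
    · simpa [hi] using hJ i
    · by_cases hi : i = G.zero
      · simpa [hi] using hJ.1.symm
      · simpa [hi] using hJ.2 i hi
  · split_ifs with hi
    · rfl
    · exact hF i hi J K hJK

theorem IsShortestPath.P_zero (h : G.IsShortestPath) (a b) {j : S} (hj : j ≠ G.zero) :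
    G.P G.zero a b j = 0 := by
  rw [PMF.apply_eq_zero_iff, (PMF.apply_eq_one_iff _ _).1 (h.absorbing a b)]
  exact hj

section Lookahead

variable [Fintype S]

/-- The expectation of `J` after one step from `i` under the combined action `a`. -/
def next (G : StochasticGame.{u, v} S) (J : S → ℝ) (i : S) (a : G.A₁ i × G.A₂ i) : ℝ :=
  ∑ j, (G.P i a.1 a.2 j).toReal * J j

/-- The expected cost of the combined action `a` in `i`, when `J` is the cost from the next state
on. -/
def lookahead (G : StochasticGame.{u, v} S) (J : S → ℝ) (i : S) (a : G.A₁ i × G.A₂ i) : ℝ :=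
  G.c i a.1 a.2 + G.next J i a

theorem next_mono {i : S} {a : G.A₁ i × G.A₂ i} {J K : S → ℝ}
    (hJK : ∀ j, G.P i a.1 a.2 j ≠ 0 → J j ≤ K j) : G.next J i a ≤ G.next K i a := by
  refine Finset.sum_le_sum fun j _ => ?_
  by_cases hP : G.P i a.1 a.2 j = 0
  · simp [hP]
  · exact mul_le_mul_of_nonneg_left (hJK j hP) ENNReal.toReal_nonneg

theorem next_congr {i : S} {a : G.A₁ i × G.A₂ i} {J K : S → ℝ}
    (hJK : ∀ j, G.P i a.1 a.2 j ≠ 0 → J j = K j) : G.next J i a = G.next K i a :=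
  le_antisymm (next_mono fun j hj => (hJK j hj).le) (next_mono fun j hj => (hJK j hj).ge)

theorem next_const_mul (r : ℝ) (J : S → ℝ) (i : S) (a : G.A₁ i × G.A₂ i) :
    G.next (fun j => r * J j) i a = r * G.next J i a := by
  simp only [next, Finset.mul_sum, mul_left_comm]

theorem IsShortestPath.next_zero (h : G.IsShortestPath) (J : S → ℝ)
    (a : G.A₁ G.zero × G.A₂ G.zero) : G.next J G.zero a = J G.zero := by
  rw [next, Finset.sum_eq_single G.zero (fun j _ hj => by simp [h.P_zero _ _ hj]) (by simp)]
  simp [h.absorbing]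

theorem IsShortestPath.lookahead_zero (h : G.IsShortestPath) (J : S → ℝ)
    (a : G.A₁ G.zero × G.A₂ G.zero) : G.lookahead J G.zero a = J G.zero := by
  rw [lookahead, h.next_zero, h.cost_zero, zero_add]

theorem IsShortestPath.exists_policyValue (h : G.IsShortestPath) (π : G.JointPolicy) :
    ∃ J : S → ℝ, J G.zero = 0 ∧ ∀ i, G.lookahead J i (π i) = J i := by
  obtain ⟨J, ⟨hJ_zero, hJ⟩, -⟩ := h.existsUnique_fixedPoint 0 (fun J i => G.lookahead J i (π i))
    fun i hi J K hJK => congrArg _ (next_congr fun j hj => hJK j ⟨hi, _, hj⟩)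
  refine ⟨J, hJ_zero, fun i => ?_⟩
  by_cases hi : i = G.zero
  · subst hi
    exact h.lookahead_zero J _
  · exact hJ i hi

/-- The cost function of the combined policy `π`, defined by its evaluation equation. -/
def IsShortestPath.policyValue (h : G.IsShortestPath) (π : G.JointPolicy) : S → ℝ :=
  (h.exists_policyValue π).choose

theorem IsShortestPath.policyValue_zero (h : G.IsShortestPath) (π : G.JointPolicy) :
    h.policyValue π G.zero = 0 :=
  (h.exists_policyValue π).choose_spec.1

theorem IsShortestPath.lookahead_policyValue (h : G.IsShortestPath) (π : G.JointPolicy) (i : S) :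
    G.lookahead (h.policyValue π) i (π i) = h.policyValue π i :=
  (h.exists_policyValue π).choose_spec.2 i

theorem IsShortestPath.le_of_le_lookahead_of_lookahead_le (h : G.IsShortestPath) {J K : S → ℝ}
    (h_zero : J G.zero ≤ K G.zero) (hJ : ∀ i, J i ≤ G.lookahead J i (π i))
    (hK : ∀ i, G.lookahead K i (π i) ≤ K i) (i : S) : J i ≤ K i := by
  induction i using h.wellFounded_isSuccessor.induction with
  | _ i ih =>
    by_cases hi : i = G.zero
    · exact hi ▸ h_zero
    · calc J i ≤ G.lookahead J i (π i) := hJ i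
        _ ≤ G.lookahead K i (π i) := by
          unfold lookahead
          gcongr
          exact next_mono fun j hj => ih j ⟨hi, _, hj⟩
        _ ≤ K i := hK i

end Lookahead

/-! ### Trajectories of positive probability -/

/-- All transitions of the trajectory `x` have positive probability under `π`. -/
def IsAdmissible (G : StochasticGame.{u, v} S) (π : G.JointPolicy) (x : ℕ → S) : Prop :=
  ∀ n, G.P (x n) (π (x n)).1 (π (x n)).2 (x (n + 1)) ≠ 0

theorem IsAdmissible.shift (hx : G.IsAdmissible π x) (m : ℕ) :
    G.IsAdmissible π fun n => x (m + n) :=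
  fun n => hx (m + n)

theorem IsAdmissible.apply_ne_zero_of_le (hx : G.IsAdmissible π x) (h : G.IsShortestPath)
    {m n : ℕ} (hmn : m ≤ n) (hn : x n ≠ G.zero) : x m ≠ G.zero := by
  refine fun hm => hn ?_
  induction n, hmn using Nat.le_induction with
  | base => exact hm
  | succ n _ ih =>
    have hxn : x n = G.zero := by_contra fun hne => hne (ih hne)
    by_contra hne
    have hP := hx n
    rw [hxn] at hP
    exact hP (h.P_zero _ _ hne)

theorem IsAdmissible.edge (hx : G.IsAdmissible π x) (h : G.IsShortestPath) {n : ℕ}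
    (hn : x (n + 1) ≠ G.zero) : G.Edge (x n) (x (n + 1)) :=
  IsSuccessor.edge ⟨hx.apply_ne_zero_of_le h n.le_succ hn, _, hx n⟩ hn

theorem IsAdmissible.transGen_edge (hx : G.IsAdmissible π x) (h : G.IsShortestPath) {m n : ℕ}
    (hmn : m < n) (hn : x n ≠ G.zero) : Relation.TransGen G.Edge (x m) (x n) := by
  induction n, hmn using Nat.le_induction with
  | base => exact .single (hx.edge h hn)
  | succ n _ ih => exact .tail (ih (hx.apply_ne_zero_of_le h n.le_succ hn)) (hx.edge h hn)

theorem IsAdmissible.apply_eq_zero [Finite S] (hx : G.IsAdmissible π x) (h : G.IsShortestPath)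
    {n : ℕ} (hn : Nat.card S ≤ n) : x n = G.zero := by
  by_contra hne
  have injective : Function.Injective fun m : Fin (n + 1) => x m :=
    Function.Injective.of_lt_imp_ne fun m m' hlt heq => h.acyclic (x m) <| by
      simpa only [← heq] using hx.transGen_edge h hlt
        (hx.apply_ne_zero_of_le h (Nat.le_of_lt_succ m'.2) hne)
  have := Nat.card_le_card_of_injective _ injective
  rw [Nat.card_fin] at this
  omega

open Classical in
/-- The indicator of the event that the history `y` up to time `n` contains the state `i`. -/
def visitIndicator (i : S) (n : ℕ) (y : ∀ _ : Finset.Iic n, S) : ℝ :=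
  if ∃ m, y m = i then 1 else 0

theorem visitIndicator_frestrictLe (i : S) (n : ℕ) (x : ℕ → S) [Decidable (∃ m ≤ n, x m = i)] :
    visitIndicator i n (Preorder.frestrictLe (π := fun _ => S) n x) =
      if ∃ m ≤ n, x m = i then 1 else 0 := by
  simp [visitIndicator, Subtype.exists]

section Deviation

variable [Fintype S]

/-- The error made at time `n` in predicting `J` one step ahead along the trajectory `x`. -/
def deviation (G : StochasticGame.{u, v} S) (π : G.JointPolicy) (J : S → ℝ) (x : ℕ → S) (n : ℕ) :
    ℝ :=
  J (x (n + 1)) - G.next J (x n) (π (x n))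

theorem IsAdmissible.deviation_eq_zero (hx : G.IsAdmissible π x) (h : G.IsShortestPath)
    (J : S → ℝ) {n : ℕ} (hn : Nat.card S ≤ n) : G.deviation π J x n = 0 := by
  rw [deviation, hx.apply_eq_zero h hn, hx.apply_eq_zero h (hn.trans n.le_succ), h.next_zero,
    sub_self]

theorem IsAdmissible.tsum_cost (hx : G.IsAdmissible π x) (h : G.IsShortestPath) :
    ∑' k, G.c (x k) (π (x k)).1 (π (x k)).2 = h.policyValue π (x 0) +
      ∑ n ∈ Finset.range (Nat.card S), G.deviation π (h.policyValue π) x n := by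
  set V := h.policyValue π
  have cost_eq : ∀ n, G.c (x n) (π (x n)).1 (π (x n)).2 =
      (V (x n) - V (x (n + 1))) + G.deviation π V x n := fun n => by
    have hV : G.lookahead V (x n) (π (x n)) = V (x n) := h.lookahead_policyValue π (x n)
    rw [← hV, lookahead, deviation]
    ring
  rw [tsum_eq_sum (s := Finset.range (Nat.card S)) fun n hn => by
      rw [hx.apply_eq_zero h (not_lt.1 fun hlt => hn (Finset.mem_range.2 hlt)), h.cost_zero],
    Finset.sum_congr rfl fun n _ => cost_eq n, Finset.sum_add_distrib, Finset.sum_range_sub',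
    hx.apply_eq_zero h le_rfl, show V G.zero = 0 from h.policyValue_zero π, sub_zero]

/-- The sum of the errors made in predicting `J` one step ahead from the first visit of `i` on.
The sum stops at `Nat.card S` because no error is made in `zero`. -/
def deviationFromVisit (G : StochasticGame.{u, v} S) (π : G.JointPolicy) (J : S → ℝ) (i : S)
    (x : ℕ → S) : ℝ :=
  ∑ n ∈ Finset.range (Nat.card S),
    visitIndicator i n (Preorder.frestrictLe (π := fun _ => S) n x) * G.deviation π J x n

theorem deviationFromVisit_eq_zero (π : G.JointPolicy) (J : S → ℝ) {i : S}
    (hi : ¬ ∃ k, x k = i) : G.deviationFromVisit π J i x = 0 := by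
  classical
  refine Finset.sum_eq_zero fun n _ => mul_eq_zero_of_left ?_ _
  rw [visitIndicator_frestrictLe, if_neg fun ⟨m, _, hm⟩ => hi ⟨m, hm⟩]

theorem exists_abs_deviationFromVisit_le (G : StochasticGame.{u, v} S) (π : G.JointPolicy)
    (J : S → ℝ) (i : S) : ∃ C, ∀ x, |G.deviationFromVisit π J i x| ≤ C := by
  obtain ⟨C, hC⟩ := (Set.finite_range fun s : S × S => |J s.2 - G.next J s.1 (π s.1)|).bddAbove
  refine ⟨Nat.card S * C, fun x => ?_⟩
  have term_le : ∀ n ∈ Finset.range (Nat.card S),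
      |visitIndicator i n (Preorder.frestrictLe (π := fun _ => S) n x) * G.deviation π J x n|
        ≤ C := fun n _ => by
    have abs_deviation_le : |G.deviation π J x n| ≤ C := hC ⟨(x n, x (n + 1)), rfl⟩
    unfold visitIndicator
    split_ifs
    · rwa [one_mul]
    · simpa using (abs_nonneg _).trans abs_deviation_le
  calc |G.deviationFromVisit π J i x| ≤ _ := Finset.abs_sum_le_sum_abs _ _
    _ ≤ Nat.card S * C := by simpa using Finset.sum_le_sum term_le

theorem IsAdmissible.tsum_cost_of_visit (hx : G.IsAdmissible π x) (h : G.IsShortestPath) {i : S}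
    (hi : ∃ k, x k = i) :
    ∑' k, G.c (x (sInf {n | x n = i} + k)) (π (x (sInf {n | x n = i} + k))).1
      (π (x (sInf {n | x n = i} + k))).2 =
    h.policyValue π i + G.deviationFromVisit π (h.policyValue π) i x := by
  classical
  set N := sInf {n | x n = i}
  set V := h.policyValue π
  have apply_N : x N = i := Nat.sInf_mem hi
  have visit_iff : ∀ n, (∃ m ≤ n, x m = i) ↔ N ≤ n := fun n =>
    ⟨fun ⟨m, hmn, hm⟩ => (Nat.sInf_le hm).trans hmn, fun hn => ⟨N, hn, apply_N⟩⟩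
  have deviationFromVisit_eq : G.deviationFromVisit π V i x =
      ∑ n ∈ Finset.range (N + Nat.card S), if N ≤ n then G.deviation π V x n else 0 := by
    simp only [deviationFromVisit, visitIndicator_frestrictLe, visit_iff, ite_mul, one_mul,
      zero_mul]
    refine Finset.sum_subset (Finset.range_mono (Nat.le_add_left _ _)) fun n _ hn => ?_
    rw [hx.deviation_eq_zero h V (not_lt.1 fun hlt => hn (Finset.mem_range.2 hlt)), ite_self]
  rw [deviationFromVisit_eq, Finset.sum_range_add, Finset.sum_eq_zero fun n hn =>
    if_neg (not_le.2 (Finset.mem_range.1 hn)), zero_add]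
  simp only [Nat.le_add_right, if_true]
  refine ((hx.shift N).tsum_cost h).trans ?_
  rw [add_zero, apply_N]
  rfl

end Deviation

/-! ### The law of the Markov chain -/

section Chain

theorem measurableSet_visits [MeasurableSpace S] [MeasurableSingletonClass S] (i : S) :
    MeasurableSet {x : ℕ → S | ∃ k, x k = i} := by
  rw [Set.ofPred_exists]
  exact .iUnion fun k => (measurableSet_singleton i).preimage (measurable_pi_apply k)

/-- The states of the trajectory `x` up to time `n`, together with the state at time `n + 1`. -/
def historyAndNext (n : ℕ) (x : ℕ → S) : (∀ _ : Finset.Iic n, S) × S :=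
  (Preorder.frestrictLe (π := fun _ => S) n x, x (n + 1))

/-- The current state `y n` of a history `y` up to time `n`. -/
def currentState {n : ℕ} (y : ∀ _ : Finset.Iic n, S) : S :=
  y ⟨n, Finset.mem_Iic.2 le_rfl⟩

variable [MeasurableSpace S]

theorem measurable_historyAndNext (n : ℕ) :
    Measurable (historyAndNext n : (ℕ → S) → (∀ _ : Finset.Iic n, S) × S) := by
  unfold historyAndNext
  fun_prop

variable [DiscreteMeasurableSpace S]

theorem measurable_comp_historyAndNext [Finite S] (n : ℕ)
    (f : (∀ _ : Finset.Iic n, S) × S → ℝ) : Measurable fun x => f (historyAndNext n x) :=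
  (measurable_of_finite f).comp (measurable_historyAndNext n)

theorem integrable_comp_historyAndNext [Finite S] {μ : Measure (ℕ → S)} [IsFiniteMeasure μ]
    (n : ℕ) (f : (∀ _ : Finset.Iic n, S) × S → ℝ) :
    Integrable (fun x => f (historyAndNext n x)) μ :=
  Integrable.of_finite.comp_measurable (measurable_historyAndNext n)

instance [Finite S] (p : PMF S) (π : G.JointPolicy) : IsProbabilityMeasure (G.chainLaw p π) := by
  have := PMF.toMeasure.isProbabilityMeasure p
  unfold chainLaw
  infer_instance

theorem chainLaw_map_historyAndNext [Finite S] (p : PMF S) (π : G.JointPolicy) (n : ℕ) :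
    (G.chainLaw p π).map (historyAndNext n) =
      (G.chainLaw p π).map (Preorder.frestrictLe (π := fun _ => S) n) ⊗ₘ G.histKernel π n := by
  have := PMF.toMeasure.isProbabilityMeasure p
  exact Kernel.map_frestrictLe_trajMeasure_compProd_eq_map_trajMeasure.symm

theorem histKernel_apply [Finite S] (π : G.JointPolicy) (n : ℕ) (y : ∀ _ : Finset.Iic n, S) :
    G.histKernel π n y =
      (G.P (currentState y) (π (currentState y)).1 (π (currentState y)).2).toMeasure :=
  rfl

theorem ae_isAdmissible [Finite S] (p : PMF S) (π : G.JointPolicy) :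
    ∀ᵐ x ∂G.chainLaw p π, G.IsAdmissible π x := by
  refine ae_all_iff.2 fun n => ae_of_ae_map (measurable_historyAndNext n).aemeasurable
    (p := fun y => G.P (currentState y.1) (π (currentState y.1)).1 (π (currentState y.1)).2 y.2 ≠ 0)
    ?_
  rw [chainLaw_map_historyAndNext, Measure.ae_compProd_iff (Set.toFinite _).measurableSet]
  refine .of_forall fun y => ?_
  rw [histKernel_apply, ae_iff, PMF.toMeasure_apply_eq_zero_iff _ (Set.toFinite _).measurableSet]
  exact Set.disjoint_left.2 fun s hs hs' => hs' ((PMF.mem_support_iff _ _).1 hs)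

theorem ae_chainLaw_pure [Finite S] (π : G.JointPolicy) (i : S) :
    ∀ᵐ x ∂G.chainLaw (PMF.pure i) π, x 0 = i := by
  have map_initial : (G.chainLaw (PMF.pure i) π).map (Preorder.frestrictLe (π := fun _ => S) 0) =
      (PMF.pure i).toMeasure.map (MeasurableEquiv.piUnique fun _ : Finset.Iic 0 => S).symm := by
    rw [chainLaw, Kernel.trajMeasure, Measure.map_comp _ _ (by fun_prop),
      Kernel.traj_map_frestrictLe, Kernel.partialTraj_self, Measure.id_comp]
  refine ae_of_ae_map (p := fun y => currentState y = i) (by fun_prop)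
    (f := Preorder.frestrictLe (π := fun _ => S) 0) ?_
  rw [map_initial, ae_map_iff (by fun_prop) (Set.toFinite _).measurableSet, PMF.toMeasure_pure,
    ae_dirac_iff (Set.toFinite _).measurableSet]
  rfl

variable [Fintype S]

theorem integral_history_mul_deviation (p : PMF S) (π : G.JointPolicy) (J : S → ℝ) (n : ℕ)
    (f : (∀ _ : Finset.Iic n, S) → ℝ) :
    ∫ x, f (Preorder.frestrictLe (π := fun _ => S) n x) * G.deviation π J x n
      ∂G.chainLaw p π = 0 := by
  let F : (∀ _ : Finset.Iic n, S) × S → ℝ := fun y =>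
    f y.1 * (J y.2 - G.next J (currentState y.1) (π (currentState y.1)))
  have : IsProbabilityMeasure
      ((G.chainLaw p π).map (Preorder.frestrictLe (π := fun _ => S) n)) :=
    Measure.isProbabilityMeasure_map (by fun_prop)
  calc ∫ x, F (historyAndNext n x) ∂G.chainLaw p π
      = ∫ y, F y ∂(G.chainLaw p π).map (historyAndNext n) :=
        (integral_map (measurable_historyAndNext n).aemeasurable
          (measurable_of_finite F).aestronglyMeasurable).symm
    _ = ∫ y, ∫ s, F (y, s) ∂G.histKernel π n y
          ∂(G.chainLaw p π).map (Preorder.frestrictLe (π := fun _ => S) n) := by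
        rw [chainLaw_map_historyAndNext, Measure.integral_compProd Integrable.of_finite]
    _ = 0 := integral_eq_zero_of_ae <| .of_forall fun y => by
        set i := currentState y
        have := PMF.toMeasure.isProbabilityMeasure (G.P i (π i).1 (π i).2)
        simp only [histKernel_apply, F]
        rw [integral_const_mul, integral_sub Integrable.of_finite (integrable_const _),
          PMF.integral_eq_sum]
        simp [next]

theorem measurable_history_mul_deviation (π : G.JointPolicy) (J : S → ℝ) (n : ℕ)
    (f : (∀ _ : Finset.Iic n, S) → ℝ) :
    Measurable fun x => f (Preorder.frestrictLe (π := fun _ => S) n x) * G.deviation π J x n :=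
  measurable_comp_historyAndNext n fun y =>
    f y.1 * (J y.2 - G.next J (currentState y.1) (π (currentState y.1)))

theorem integrable_history_mul_deviation (p : PMF S) (π : G.JointPolicy) (J : S → ℝ) (n : ℕ)
    (f : (∀ _ : Finset.Iic n, S) → ℝ) :
    Integrable (fun x => f (Preorder.frestrictLe (π := fun _ => S) n x) * G.deviation π J x n)
      (G.chainLaw p π) :=
  integrable_comp_historyAndNext n fun y =>
    f y.1 * (J y.2 - G.next J (currentState y.1) (π (currentState y.1)))

theorem measurable_deviationFromVisit (G : StochasticGame.{u, v} S) (π : G.JointPolicy)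
    (J : S → ℝ) (i : S) : Measurable (G.deviationFromVisit π J i) :=
  Finset.measurable_fun_sum _ fun n _ => measurable_history_mul_deviation π J n _

theorem integral_deviationFromVisit (G : StochasticGame.{u, v} S) (p : PMF S)
    (π : G.JointPolicy) (J : S → ℝ) (i : S) :
    ∫ x, G.deviationFromVisit π J i x ∂G.chainLaw p π = 0 := by
  simp only [deviationFromVisit]
  rw [integral_finsetSum _ fun n _ => integrable_history_mul_deviation p π J n _]
  exact Finset.sum_eq_zero fun n _ => integral_history_mul_deviation p π J n _

theorem cost_eq_policyValue (h : G.IsShortestPath) (μ : ∀ i, G.A₁ i) (ν : ∀ i, G.A₂ i) (i : S) :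
    G.cost μ ν i = h.policyValue (G.joint μ ν) i := by
  set π := G.joint μ ν
  set V := h.policyValue π
  have deviation_integrable : ∀ n, Integrable (fun x => G.deviation π V x n)
      (G.chainLaw (PMF.pure i) π) := fun n => by
    simpa only [one_mul] using
      integrable_history_mul_deviation (PMF.pure i) π V n fun _ => 1
  have integral_deviation : ∀ n, ∫ x, G.deviation π V x n ∂G.chainLaw (PMF.pure i) π = 0 :=
    fun n => by
      simpa only [one_mul] using integral_history_mul_deviation (PMF.pure i) π V n fun _ => 1
  calc G.cost μ ν i
      = ∫ x, V i + ∑ n ∈ Finset.range (Nat.card S), G.deviation π V x n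
          ∂G.chainLaw (PMF.pure i) π := by
        refine integral_congr_ae ?_
        filter_upwards [ae_isAdmissible (PMF.pure i) π, ae_chainLaw_pure π i] with x hx hx_zero
        exact hx_zero ▸ hx.tsum_cost h
    _ = V i := by
        rw [integral_add (integrable_const _)
          (integrable_finsetSum _ fun n _ => deviation_integrable n),
          integral_finsetSum _ fun n _ => deviation_integrable n,
          Finset.sum_eq_zero fun n _ => integral_deviation n]
        simp

end Chain

end StochasticGame

namespace AlternatingGame

open StochasticGame

variable {S : Type u} {G : AlternatingGame.{u, v} S} {J : S → ℝ} {π : G.JointPolicy}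

/-! ### The change of sign -/

open Classical in
/-- The factor by which the player who moves in `i` counts costs: `-1` if it is player 2, who
maximizes, and `1` otherwise. -/
def moverSign (G : AlternatingGame.{u, v} S) (i : S) : ℝ :=
  if i ∈ G.S₂ then -1 else 1

theorem zero_notMem_S₂ (G : AlternatingGame.{u, v} S) : G.zero ∉ G.S₂ := fun hmem => by
  have : G.zero ∈ ({G.zero}ᶜ : Set S) := G.cover ▸ Or.inr hmem
  exact this rfl

theorem mem_S₁_of_notMem_S₂ {i : S} (hi : i ≠ G.zero) (hi₂ : i ∉ G.S₂) : i ∈ G.S₁ := by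
  have : i ∈ G.S₁ ∪ G.S₂ := G.cover ▸ hi
  exact this.resolve_right hi₂

theorem moverSign_of_mem {i : S} (hi : i ∈ G.S₂) : G.moverSign i = -1 := if_pos hi

theorem moverSign_of_notMem {i : S} (hi : i ∉ G.S₂) : G.moverSign i = 1 := if_neg hi

theorem moverSign_mul_self (G : AlternatingGame.{u, v} S) (i : S) :
    G.moverSign i * G.moverSign i = 1 := by
  unfold moverSign
  split_ifs <;> norm_num

theorem abs_moverSign (G : AlternatingGame.{u, v} S) (i : S) : |G.moverSign i| = 1 := by
  unfold moverSign
  split_ifs <;> norm_num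

theorem moverSign_eq_neg_of_edge {i j : S} (hij : G.Edge i j) :
    G.moverSign j = -G.moverSign i := by
  obtain ⟨hi, hj, a, ha⟩ := hij
  by_cases hi₂ : i ∈ G.S₂ <;> by_cases hj₂ : j ∈ G.S₂
  · exact absurd (G.alternate i j a.1 a.2 (Or.inr ⟨hi₂, hj₂⟩)) ha.ne'
  · rw [moverSign_of_mem hi₂, moverSign_of_notMem hj₂, neg_neg]
  · rw [moverSign_of_notMem hi₂, moverSign_of_mem hj₂]
  · exact absurd (G.alternate i j a.1 a.2
      (Or.inl ⟨mem_S₁_of_notMem_S₂ hi hi₂, mem_S₁_of_notMem_S₂ hj hj₂⟩)) ha.ne'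

theorem flip_apply (G : AlternatingGame.{u, v} S) (J : S → ℝ) (i : S) :
    G.flip J i = G.moverSign i * J i := by
  unfold flip moverSign
  split_ifs <;> ring

theorem negCost_eq (G : AlternatingGame.{u, v} S) (i : S) (a : G.A₁ i × G.A₂ i) :
    G.negCost i a = G.moverSign i * G.c i a.1 a.2 := by
  unfold negCost moverSign
  split_ifs <;> ring

theorem flip_flip (G : AlternatingGame.{u, v} S) (J : S → ℝ) : G.flip (G.flip J) = J :=
  funext fun i => by rw [flip_apply, flip_apply, ← mul_assoc, moverSign_mul_self, one_mul]

theorem flip_zero (G : AlternatingGame.{u, v} S) (J : S → ℝ) : G.flip J G.zero = J G.zero := by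
  rw [flip_apply, moverSign_of_notMem G.zero_notMem_S₂, one_mul]

theorem moverSign_apply_eq (h : G.IsShortestPath) {x : ℕ → S} (hx : G.IsAdmissible π x) {n : ℕ}
    (hn : x n ≠ G.zero) : G.moverSign (x n) = (-1) ^ n * G.moverSign (x 0) := by
  induction n with
  | zero => rw [pow_zero, one_mul]
  | succ n ih =>
    rw [moverSign_eq_neg_of_edge (hx.edge h hn), ih (hx.apply_ne_zero_of_le h n.le_succ hn)]
    ring

theorem neg_one_pow_mul_negCost (h : G.IsShortestPath) {x : ℕ → S} (hx : G.IsAdmissible π x)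
    (n : ℕ) : (-1) ^ n * G.negCost (x n) (π (x n)) =
      G.moverSign (x 0) * G.c (x n) (π (x n)).1 (π (x n)).2 := by
  by_cases hn : x n = G.zero
  · rw [hn, negCost_eq, h.cost_zero, mul_zero, mul_zero, mul_zero]
  · rw [negCost_eq, moverSign_apply_eq h hx hn, ← mul_assoc, ← mul_assoc, ← mul_pow, neg_one_mul,
      neg_neg, one_pow, one_mul]

variable [Fintype S]

/-! ### The negamin operator -/

theorem negQ_eq (J : S → ℝ) (i : S) (a : G.A₁ i × G.A₂ i) :
    G.negQ J i a = G.negCost i a - G.next J i a := rfl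

theorem next_flip (h : G.IsShortestPath) (hJ : J G.zero = 0) (i : S) (a : G.A₁ i × G.A₂ i) :
    G.next (G.flip J) i a = -G.moverSign i * G.next J i a := by
  rw [← next_const_mul]
  refine next_congr fun j hj => ?_
  rw [flip_apply]
  by_cases hj_zero : j = G.zero
  · rw [hj_zero, hJ, mul_zero, mul_zero]
  · have hi : i ≠ G.zero := by
      rintro rfl
      exact hj (h.P_zero _ _ hj_zero)
    rw [moverSign_eq_neg_of_edge (IsSuccessor.edge ⟨hi, a, hj⟩ hj_zero)]

theorem negQ_flip (h : G.IsShortestPath) (hJ : J G.zero = 0) (i : S) (a : G.A₁ i × G.A₂ i) :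
    G.negQ (G.flip J) i a = G.moverSign i * G.lookahead J i a := by
  rw [negQ_eq, next_flip h hJ, negCost_eq, lookahead]
  ring

theorem negQ_congr {i : S} (hi : i ≠ G.zero) {K : S → ℝ}
    (hJK : ∀ j, G.IsSuccessor j i → J j = K j) (a : G.A₁ i × G.A₂ i) :
    G.negQ J i a = G.negQ K i a :=
  congrArg _ (next_congr fun j hj => hJK j ⟨hi, a, hj⟩)

theorem negaminOp_zero (h : G.IsShortestPath) (J : S → ℝ) :
    G.negaminOp J G.zero = -J G.zero := by
  simp only [negaminOp, negQ_eq, h.next_zero, negCost_eq, h.cost_zero, mul_zero, zero_sub,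
    ciInf_const]

theorem negaminOp_le (J : S → ℝ) (i : S) (a : G.A₁ i × G.A₂ i) :
    G.negaminOp J i ≤ G.negQ J i a :=
  ciInf_le (Set.finite_range _).bddBelow a

theorem IsGreedy.negaminOp_eq (hπ : G.IsGreedy J π) (i : S) :
    G.negaminOp J i = G.negQ J i (π i) :=
  le_antisymm (negaminOp_le J i _) (le_ciInf (hπ i))

theorem exists_isGreedy (G : AlternatingGame.{u, v} S) (J : S → ℝ) :
    ∃ π : G.JointPolicy, G.IsGreedy J π := by
  choose π hπ using fun i => Finite.exists_min (G.negQ J i)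
  exact ⟨π, hπ⟩

theorem negaminOp_eq_self_iff (h : G.IsShortestPath) :
    G.negaminOp J = J ↔ J G.zero = 0 ∧ ∀ i ≠ G.zero, G.negaminOp J i = J i := by
  refine ⟨fun hJ => ⟨?_, fun i _ => congrFun hJ i⟩, fun ⟨hJ_zero, hJ⟩ => funext fun i => ?_⟩
  · exact neg_eq_self.1 (negaminOp_zero h J ▸ congrFun hJ G.zero)
  · by_cases hi : i = G.zero
    · rw [hi, negaminOp_zero h, hJ_zero, neg_zero]
    · exact hJ i hi

theorem existsUnique_negaminOp_eq_self (h : G.IsShortestPath) :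
    ∃! J : S → ℝ, G.negaminOp J = J := by
  simp only [negaminOp_eq_self_iff h]
  exact h.existsUnique_fixedPoint 0 G.negaminOp fun i hi J K hJK =>
    iInf_congr (negQ_congr hi hJK)

/-! ### The value of the game -/

theorem lookahead_saddlePoint (h : G.IsShortestPath) (hJ : G.negaminOp (G.flip J) = G.flip J)
    (hπ : G.IsGreedy (G.flip J) π) (i : S) :
    (∀ v, G.lookahead J i ((π i).1, v) ≤ J i) ∧ ∀ u, J i ≤ G.lookahead J i (u, (π i).2) := by
  have hJ_zero : J G.zero = 0 := flip_zero G J ▸ ((negaminOp_eq_self_iff h).1 hJ).1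
  have sign_mul_le : ∀ a, G.moverSign i * J i ≤ G.moverSign i * G.lookahead J i a := fun a => by
    rw [← negQ_flip h hJ_zero, ← flip_apply]
    exact (congrFun hJ i).ge.trans (negaminOp_le _ i a)
  have lookahead_eq : G.lookahead J i (π i) = J i := by
    refine mul_left_cancel₀ (left_ne_zero_of_mul_eq_one (G.moverSign_mul_self i)) ?_
    rw [← negQ_flip h hJ_zero, ← flip_apply, ← hπ.negaminOp_eq, hJ]
  by_cases hi : i ∈ G.S₂
  · have := G.trivial₁ i hi
    simp only [moverSign_of_mem hi, neg_one_mul, neg_le_neg_iff] at sign_mul_le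
    exact ⟨fun v => sign_mul_le _, fun u => Subsingleton.elim (π i).1 u ▸ lookahead_eq.ge⟩
  · simp only [moverSign_of_notMem hi, one_mul] at sign_mul_le
    refine ⟨fun v => ?_, fun u => sign_mul_le _⟩
    by_cases hi_zero : i = G.zero
    · subst hi_zero
      exact (h.lookahead_zero J _).le
    · have := G.trivial₂ i (mem_S₁_of_notMem_S₂ hi_zero hi)
      exact Subsingleton.elim (π i).2 v ▸ lookahead_eq.le

theorem minimaxOp_eq_self (h : G.IsShortestPath) (hJ : G.negaminOp (G.flip J) = G.flip J) :
    G.minimaxOp J = J := by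
  obtain ⟨π, hπ⟩ := G.exists_isGreedy (G.flip J)
  refine funext fun i => (iInf_iSup_eq_of_saddlePoint
    (f := fun u v => G.lookahead J i (u, v)) (π i).1 (π i).2 ?_ ?_).1
  · exact (lookahead_saddlePoint h hJ hπ i).1
  · exact (lookahead_saddlePoint h hJ hπ i).2

theorem isValue_of_negaminOp_flip_eq [MeasurableSpace S] [DiscreteMeasurableSpace S]
    (h : G.IsShortestPath) (hJ : G.negaminOp (G.flip J) = G.flip J) : G.IsValue J := by
  obtain ⟨π, hπ⟩ := G.exists_isGreedy (G.flip J)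
  have hJ_zero : J G.zero = 0 := flip_zero G J ▸ ((negaminOp_eq_self_iff h).1 hJ).1
  have saddlePoint := lookahead_saddlePoint h hJ hπ
  refine fun i => iInf_iSup_eq_of_saddlePoint (fun i => (π i).1) (fun i => (π i).2)
    (fun ν => ?_) fun μ => ?_
  · rw [cost_eq_policyValue h]
    exact h.le_of_le_lookahead_of_lookahead_le (by rw [hJ_zero, h.policyValue_zero])
      (fun i => (h.lookahead_policyValue _ i).ge) (fun i => (saddlePoint i).1 (ν i)) i
  · rw [cost_eq_policyValue h]
    exact h.le_of_le_lookahead_of_lookahead_le (by rw [hJ_zero, h.policyValue_zero])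
      (fun i => (saddlePoint i).2 (μ i)) (fun i => (h.lookahead_policyValue _ i).le) i

/-! ### The Monte Carlo estimate -/

/-- The error of the Monte Carlo estimate for `i` along the trajectory `x`. -/
def estimateError (h : G.IsShortestPath) (π : G.JointPolicy) (i : S) (x : ℕ → S) : ℝ :=
  G.moverSign i * G.deviationFromVisit π (h.policyValue π) i x

theorem estimate_eq (h : G.IsShortestPath) {x : ℕ → S} (hx : G.IsAdmissible π x) {i : S}
    (hi : ∃ k, x k = i) :
    G.estimate x π i = G.flip (h.policyValue π) i + estimateError h π i x := by
  have apply_firstVisit : x (sInf {n | x n = i} + 0) = i := Nat.sInf_mem hi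
  rw [estimate, tsum_congr (neg_one_pow_mul_negCost h (hx.shift _)), tsum_mul_left,
    hx.tsum_cost_of_visit h hi, apply_firstVisit, mul_add, flip_apply, estimateError]

theorem estimateError_eq_zero (h : G.IsShortestPath) (π : G.JointPolicy) {i : S} {x : ℕ → S}
    (hi : ¬ ∃ k, x k = i) : estimateError h π i x = 0 := by
  rw [estimateError, deviationFromVisit_eq_zero π _ hi, mul_zero]

theorem exists_abs_estimateError_le (h : G.IsShortestPath) :
    ∃ C, ∀ π i x, |estimateError h π i x| ≤ C := by
  choose C hC using fun y : G.JointPolicy × S =>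
    G.exists_abs_deviationFromVisit_le y.1 (h.policyValue y.1) y.2
  obtain ⟨B, hB⟩ := (Set.finite_range C).bddAbove
  refine ⟨B, fun π i x => ?_⟩
  rw [estimateError, abs_mul, abs_moverSign, one_mul]
  exact (hC (π, i) x).trans (hB ⟨_, rfl⟩)

variable [MeasurableSpace S] [DiscreteMeasurableSpace S]

theorem measurable_estimateError (h : G.IsShortestPath) (π : G.JointPolicy) (i : S) :
    Measurable (estimateError h π i) :=
  (G.measurable_deviationFromVisit π _ i).const_mul _

theorem integral_estimateError (h : G.IsShortestPath) (p : PMF S) (π : G.JointPolicy) (i : S) :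
    ∫ x, estimateError h π i x ∂G.chainLaw p π = 0 := by
  simp only [estimateError]
  rw [integral_const_mul, integral_deviationFromVisit, mul_zero]

end AlternatingGame

/-! ### Step sizes -/

theorem sum_range_ite_count {M : Type*} [AddCommMonoid M] (P : ℕ → Prop) [DecidablePred P]
    (f : ℕ → M) (n : ℕ) :
    ∑ t ∈ Finset.range n, (if P t then f (Nat.count P t) else 0) =
      ∑ m ∈ Finset.range (Nat.count P n), f m := by
  induction n with
  | zero => simp
  | succ n ih =>
    rw [Finset.sum_range_succ, ih, Nat.count_succ]
    split_ifs
    · rw [Finset.sum_range_succ]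
    · rw [add_zero, add_zero]

theorem tendsto_count_atTop_of_not_summable {P : ℕ → Prop} [DecidablePred P] {b : ℕ → ℝ}
    (h : ¬ Summable fun t => if P t then b t else 0) :
    Tendsto (Nat.count P) atTop atTop := by
  have hP : {t | P t}.Infinite := fun hfin =>
    h (summable_of_hasFiniteSupport (hfin.subset fun t ht => by
      by_contra hPt
      exact ht (if_neg hPt)))
  exact tendsto_atTop_atTop_of_monotone (Nat.count_monotone P) fun m =>
    ⟨Nat.nth P m, (Nat.count_nth_of_infinite hP m).ge⟩

theorem not_summable_of_tendsto_sum_sub {f g : ℕ → ℝ} {L : ℝ}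
    (hg : Tendsto (fun n => ∑ t ∈ Finset.range n, g t) atTop atTop)
    (hfg : Tendsto (fun n => ∑ t ∈ Finset.range n, (f t - g t)) atTop (𝓝 L)) :
    ¬ Summable f := fun hf => by
  refine not_tendsto_nhds_of_tendsto_atTop hg (∑' t, f t - L) ?_
  refine (hf.hasSum.tendsto_sum_nat.sub hfg).congr fun n => ?_
  rw [Finset.sum_sub_distrib, sub_sub_cancel]

section ActiveStep

variable {S : Type u} {β : ℕ → ℝ} {rule : StepRule} {x : ℕ → ℕ → S} {i : S}

open Classical in
/-- The step size with which iteration `t` moves the value at `i`: it is `γ_t(i)` if the trajectory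
`x t` visits `i`, and `0` otherwise. -/
def activeStep (β : ℕ → ℝ) (rule : StepRule) (x : ℕ → ℕ → S) (i : S) (t : ℕ) : ℝ :=
  if ∃ k, x t k = i then stepSize β x t i rule else 0

theorem stepSize_visits [DecidablePred fun t => ∃ k, x t k = i] (t : ℕ) :
    stepSize β x t i .visits = β (Nat.count (fun t => ∃ k, x t k = i) t) := by
  rw [stepSize, Nat.count_eq_card_filter_range]
  congr!

theorem activeStep_nonneg (hβ : ∀ t, 0 ≤ β t) (t : ℕ) : 0 ≤ activeStep β rule x i t := by
  unfold activeStep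
  split_ifs
  · cases rule <;> exact hβ _
  · exact le_rfl

theorem sum_sq_activeStep_le (hβ : Summable fun t => β t ^ 2) (n : ℕ) :
    ∑ t ∈ Finset.range n, activeStep β rule x i t ^ 2 ≤ ∑' t, β t ^ 2 := by
  classical
  simp only [activeStep, ite_pow, zero_pow two_ne_zero]
  cases rule with
  | time =>
    refine (Finset.sum_le_sum fun t _ => ?_).trans
      (hβ.sum_le_tsum (Finset.range n) fun t _ => sq_nonneg _)
    split_ifs
    · exact le_rfl
    · exact sq_nonneg _
  | visits =>
    simp only [stepSize_visits]
    rw [sum_range_ite_count _ fun m => β m ^ 2]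
    exact hβ.sum_le_tsum _ fun t _ => sq_nonneg _

theorem eventually_activeStep_le_one (hβ : Summable fun t => β t ^ 2) :
    ∀ᶠ t in atTop, activeStep β rule x i t ≤ 1 := by
  have sq_summable : Summable fun t => activeStep β rule x i t ^ 2 :=
    summable_of_sum_range_le (fun t => sq_nonneg _) (sum_sq_activeStep_le hβ)
  filter_upwards [sq_summable.tendsto_atTop_zero.eventually_le_const one_pos] with t ht
  exact (abs_le.1 ((sq_le_one_iff_abs_le_one _).1 ht)).2

open Classical in
theorem not_summable_activeStep (hβ_nonneg : ∀ t, 0 ≤ β t) (hβ : ¬ Summable β)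
    (h : ¬ Summable fun t => if ∃ k, x t k = i then β t else 0) :
    ¬ Summable (activeStep β rule x i) := by
  cases rule with
  | time => exact h
  | visits =>
    rw [not_summable_iff_tendsto_nat_atTop_of_nonneg (activeStep_nonneg hβ_nonneg)]
    refine (((not_summable_iff_tendsto_nat_atTop_of_nonneg hβ_nonneg).1 hβ).comp
      (tendsto_count_atTop_of_not_summable h)).congr fun n => ?_
    simp only [Function.comp_apply, activeStep, stepSize_visits]
    rw [sum_range_ite_count]

end ActiveStep

namespace AlternatingGame

open StochasticGame

variable {S : Type u} [Fintype S] {G : AlternatingGame.{u, v} S}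

/-! ### Convergence of the iterates -/

theorem eventually_negQ_eq_negaminOp {J : S → ℝ} {K : ℕ → S → ℝ} {π : ℕ → G.JointPolicy}
    (hgreedy : ∀ t, G.IsGreedy (K t) (π t)) {i : S} (hi : i ≠ G.zero)
    (hK : ∀ j, G.IsSuccessor j i → Tendsto (fun t => K t j) atTop (𝓝 (J j))) :
    ∀ᶠ t in atTop, G.negQ J i (π t i) = G.negaminOp J i := by
  have negQ_tendsto : ∀ a, Tendsto (fun t => G.negQ (K t) i a) atTop (𝓝 (G.negQ J i a)) :=
    fun a => by
      refine tendsto_const_nhds.sub (tendsto_finsetSum _ fun j _ => ?_)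
      by_cases hj : G.P i a.1 a.2 j = 0
      · simp only [hj, ENNReal.toReal_zero, zero_mul, tendsto_const_nhds]
      · exact (hK j ⟨hi, a, hj⟩).const_mul _
  have eventually_not_lt : ∀ᶠ t in atTop, ∀ b, ¬ G.negQ J i b < G.negQ J i (π t i) := by
    have separated : ∀ᶠ t in atTop, ∀ a b, G.negQ J i b < G.negQ J i a →
        G.negQ (K t) i b < G.negQ (K t) i a := by
      simp only [eventually_all]
      exact fun a b => (negQ_tendsto b).eventually_lt (negQ_tendsto a)
    filter_upwards [separated] with t ht b hb
    exact (hgreedy t i b).not_gt (ht _ b hb)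
  filter_upwards [eventually_not_lt] with t ht
  exact le_antisymm (le_ciInf fun b => not_lt.1 (ht b)) (negaminOp_le J i _)

theorem flip_policyValue_eq_negQ (h : G.IsShortestPath) (π : G.JointPolicy) (i : S) :
    G.flip (h.policyValue π) i = G.negQ (G.flip (h.policyValue π)) i (π i) := by
  rw [negQ_flip h (h.policyValue_zero π), h.lookahead_policyValue, flip_apply]

theorem iterate_succ_eq (h : G.IsShortestPath) {β : ℕ → ℝ} {rule : StepRule} {J₀ : S → ℝ}
    {x : ℕ → ℕ → S} {π : ℕ → G.JointPolicy} {t : ℕ} (hx : G.IsAdmissible (π t) (x t)) (i : S) :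
    G.iterate β rule J₀ x π (t + 1) i = G.iterate β rule J₀ x π t i +
      activeStep β rule x i t •
        (G.flip (h.policyValue (π t)) i - G.iterate β rule J₀ x π t i) +
      activeStep β rule x i t * estimateError h (π t) i (x t) := by
  simp only [iterate, activeStep, smul_eq_mul]
  split_ifs with hi
  · rw [estimate_eq h hx hi]
    ring
  · ring

theorem tendsto_iterate (h : G.IsShortestPath) {β : ℕ → ℝ} (hβ_nonneg : ∀ t, 0 ≤ β t)
    (hβ_sq : Summable fun t => β t ^ 2) {rule : StepRule} {J₀ J : S → ℝ}
    (hJ : G.negaminOp J = J) {x : ℕ → ℕ → S} {π : ℕ → G.JointPolicy}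
    (hgreedy : ∀ t, G.IsGreedy (G.iterate β rule J₀ x π t) (π t))
    (hx : ∀ t, G.IsAdmissible (π t) (x t))
    (hsum : ∀ i, ¬ Summable (activeStep β rule x i))
    (hnoise : ∀ i, ∃ L, Tendsto (fun n => ∑ t ∈ Finset.range n,
      activeStep β rule x i t * estimateError h (π t) i (x t)) atTop (𝓝 L)) (i : S) :
    Tendsto (fun t => G.iterate β rule J₀ x π t i) atTop (𝓝 (J i)) := by
  have tendsto_of_eventually_eq : ∀ i,
      (∀ᶠ t in atTop, G.flip (h.policyValue (π t)) i = J i) →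
        Tendsto (fun t => G.iterate β rule J₀ x π t i) atTop (𝓝 (J i)) := fun i hi => by
    obtain ⟨L, hL⟩ := hnoise i
    refine tendsto_of_stochasticApproximation (activeStep_nonneg hβ_nonneg)
      (eventually_activeStep_le_one hβ_sq) (hsum i) hL ?_
    filter_upwards [hi] with t ht
    rw [iterate_succ_eq h (hx t), ht]
  refine tendsto_of_eventually_eq i ?_
  induction i using h.wellFounded_isSuccessor.induction with
  | _ i ih =>
    by_cases hi : i = G.zero
    · refine .of_forall fun t => ?_
      rw [hi, flip_zero, h.policyValue_zero, ((negaminOp_eq_self_iff h).1 hJ).1]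
    · have successors_eq : ∀ᶠ t in atTop, ∀ j, G.IsSuccessor j i →
          G.flip (h.policyValue (π t)) j = J j := by
        simpa only [eventually_all, eventually_imp_distrib_left] using ih
      filter_upwards [successors_eq, eventually_negQ_eq_negaminOp hgreedy hi fun j hj =>
        tendsto_of_eventually_eq j (ih j hj)] with t h_successors h_negQ
      rw [flip_policyValue_eq_negQ, negQ_congr hi h_successors, h_negQ, hJ]

/-! ### Almost sure properties of a run -/

section Run

variable [MeasurableSpace S] [DiscreteMeasurableSpace S] {p : PMF S} {β : ℕ → ℝ}
  {rule : StepRule} {J₀ : S → ℝ} {Ω : Type z} {mΩ : MeasurableSpace Ω} {Pr : Measure Ω}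
  {ℱ : Filtration ℕ mΩ} {X : ℕ → Ω → ℕ → S} {pol : ℕ → Ω → G.JointPolicy}
  {g : G.JointPolicy → (ℕ → S) → ℝ}

theorem IsRun.measurable_trajectory (run : G.IsRun p β rule J₀ Pr ℱ X pol) (t : ℕ) :
    Measurable (X t) :=
  (run.measurable_X t).mono (ℱ.le _) le_rfl

theorem IsRun.measurable_comp (run : G.IsRun p β rule J₀ Pr ℱ X pol) (t : ℕ)
    (hg : ∀ π, Measurable (g π)) : Measurable[ℱ (t + 1)] fun ω => g (pol t ω) (X t ω) :=
  measurable_apply_of_countable (fun π => ℱ.mono t.le_succ _ (run.measurable_pol t π))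
    (run.measurable_X t) hg

theorem IsRun.measurable_stepSize (run : G.IsRun p β rule J₀ Pr ℱ X pol) (t : ℕ) (i : S) :
    Measurable[ℱ t] fun ω => stepSize β (fun s => X s ω) t i rule := by
  cases rule with
  | time => exact measurable_const
  | visits =>
    classical
    refine (measurable_of_countable β).comp ?_
    simp only [Finset.card_filter]
    refine Finset.measurable_fun_sum _ fun τ hτ => .ite ?_ measurable_const measurable_const
    exact ℱ.mono (Finset.mem_range.1 hτ) _ (run.measurable_X τ (measurableSet_visits i))

variable [IsFiniteMeasure Pr]

theorem IsRun.map_restrict (run : G.IsRun p β rule J₀ Pr ℱ X pol) (t : ℕ) {π : G.JointPolicy}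
    {A : Set Ω} (hA : MeasurableSet[ℱ t] A) (hAπ : ∀ ω ∈ A, pol t ω = π) :
    (Pr.restrict A).map (X t) = Pr A • G.chainLaw p π := by
  ext B hB
  have preimage_measurable : MeasurableSet (X t ⁻¹' B) := run.measurable_trajectory t hB
  have real_eq : Pr.real (X t ⁻¹' B ∩ A) = Pr.real A * (G.chainLaw p π).real B :=
    calc Pr.real (X t ⁻¹' B ∩ A)
        = ∫ ω in A, (Pr⟦X t ⁻¹' B | ℱ t⟧) ω ∂Pr := by
          rw [setIntegral_condExp (ℱ.le t)
            ((integrable_const _).indicator preimage_measurable) hA,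
            integral_indicator_const _ preimage_measurable, smul_eq_mul, mul_one,
            measureReal_restrict_apply preimage_measurable]
      _ = ∫ _ in A, (G.chainLaw p π).real B ∂Pr := by
          refine setIntegral_congr_ae (ℱ.le t _ hA) ?_
          filter_upwards [run.law t B hB] with ω hω hωA
          rw [hω, hAπ ω hωA]
      _ = Pr.real A * (G.chainLaw p π).real B := by
          rw [setIntegral_const, smul_eq_mul]
  rw [Measure.map_apply (run.measurable_trajectory t) hB,
    Measure.restrict_apply preimage_measurable, Measure.smul_apply, smul_eq_mul,
    ← ENNReal.toReal_eq_toReal_iff' (measure_ne_top _ _)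
      (ENNReal.mul_ne_top (measure_ne_top _ _) (measure_ne_top _ _)), ENNReal.toReal_mul]
  exact real_eq

theorem IsRun.ae_isAdmissible (run : G.IsRun p β rule J₀ Pr ℱ X pol) :
    ∀ᵐ ω ∂Pr, ∀ t, G.IsAdmissible (pol t ω) (X t ω) := by
  refine ae_all_iff.2 fun t => ?_
  have of_pol_eq : ∀ᵐ ω ∂Pr, ∀ π, pol t ω = π → G.IsAdmissible π (X t ω) := by
    refine ae_all_iff.2 fun π => (ae_restrict_iff' (ℱ.le t _ (run.measurable_pol t π))).1 ?_
    refine ae_of_ae_map (run.measurable_trajectory t).aemeasurable ?_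
    rw [run.map_restrict t (run.measurable_pol t π) fun ω hω => hω]
    exact Measure.ae_smul_measure (StochasticGame.ae_isAdmissible p π) _
  exact of_pol_eq.mono fun ω hω => hω _ rfl

theorem IsRun.integrableOn_comp (run : G.IsRun p β rule J₀ Pr ℱ X pol) (t : ℕ)
    {π : G.JointPolicy} {A : Set Ω} (hA : MeasurableSet[ℱ t] A) (hAπ : ∀ ω ∈ A, pol t ω = π)
    {f : (ℕ → S) → ℝ} (hf : Integrable f (G.chainLaw p π)) :
    IntegrableOn (fun ω => f (X t ω)) A Pr := by
  refine Integrable.comp_measurable ?_ (run.measurable_trajectory t)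
  rw [run.map_restrict t hA hAπ]
  exact hf.smul_measure (measure_ne_top _ _)

theorem IsRun.integrable_comp (run : G.IsRun p β rule J₀ Pr ℱ X pol) (t : ℕ)
    (hg : ∀ π, Integrable (g π) (G.chainLaw p π)) :
    Integrable (fun ω => g (pol t ω) (X t ω)) Pr := by
  have iUnion_pol : ⋃ π, {ω | pol t ω = π} = Set.univ := Set.iUnion_eq_univ_iff.2 fun ω => ⟨_, rfl⟩
  rw [← integrableOn_univ, ← iUnion_pol, integrableOn_finite_iUnion]
  intro π
  have pol_measurable := run.measurable_pol t π
  refine (integrableOn_congr_fun (fun ω hω => ?_) (ℱ.le t _ pol_measurable)).2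
    (run.integrableOn_comp t pol_measurable (fun ω hω => hω) (hg π))
  rw [show pol t ω = π from hω]

theorem IsRun.setIntegral_comp [Fintype G.JointPolicy] (run : G.IsRun p β rule J₀ Pr ℱ X pol)
    (t : ℕ) {A : Set Ω} (hA : MeasurableSet[ℱ t] A) (hg : ∀ π, Measurable (g π))
    (hg_int : ∀ π, Integrable (g π) (G.chainLaw p π)) :
    ∫ ω in A, g (pol t ω) (X t ω) ∂Pr =
      ∑ π, Pr.real (A ∩ {ω | pol t ω = π}) * ∫ x, g π x ∂G.chainLaw p π := by
  have piece_measurable : ∀ π, MeasurableSet[ℱ t] (A ∩ {ω | pol t ω = π}) := fun π =>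
    hA.inter (run.measurable_pol t π)
  have piece_disjoint : Pairwise (Function.onFun Disjoint fun π => A ∩ {ω | pol t ω = π}) :=
    fun π σ hπσ => Set.disjoint_left.2 fun ω hω hω' => hπσ (hω.2.symm.trans hω'.2)
  have iUnion_piece : A = ⋃ π, A ∩ {ω | pol t ω = π} := by
    ext ω
    simp
  conv_lhs => rw [iUnion_piece]
  rw [integral_iUnion_fintype (fun π => ℱ.le t _ (piece_measurable π)) piece_disjoint
    fun π => (run.integrable_comp t hg_int).integrableOn]
  refine Finset.sum_congr rfl fun π _ => ?_
  calc ∫ ω in A ∩ {ω | pol t ω = π}, g (pol t ω) (X t ω) ∂Pr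
      = ∫ ω in A ∩ {ω | pol t ω = π}, g π (X t ω) ∂Pr :=
        setIntegral_congr_fun (ℱ.le t _ (piece_measurable π)) fun ω hω => by
          simp only [show pol t ω = π from hω.2]
    _ = Pr.real (A ∩ {ω | pol t ω = π}) * ∫ x, g π x ∂G.chainLaw p π := by
        rw [← integral_map (run.measurable_trajectory t).aemeasurable (hg π).aestronglyMeasurable,
          run.map_restrict t (piece_measurable π) fun ω hω => hω.2, integral_smul_measure,
          smul_eq_mul, measureReal_def]

theorem IsRun.condExp_comp (run : G.IsRun p β rule J₀ Pr ℱ X pol) (t : ℕ)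
    (hg : ∀ π, Measurable (g π)) (hg_int : ∀ π, Integrable (g π) (G.chainLaw p π)) :
    Pr[fun ω => g (pol t ω) (X t ω) | ℱ t] =ᵐ[Pr]
      fun ω => ∫ x, g (pol t ω) x ∂G.chainLaw p (pol t ω) := by
  have := Fintype.ofFinite G.JointPolicy
  set m : G.JointPolicy → ℝ := fun π => ∫ x, g π x ∂G.chainLaw p π
  have m_integrable : ∀ π, Integrable (fun _ => m π) (G.chainLaw p π) := fun π => integrable_const _
  have m_measurable : Measurable[ℱ t] fun ω => m (pol t ω) :=
    measurable_apply_of_countable (h := fun _ => ()) (run.measurable_pol t) measurable_const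
      fun _ => measurable_const
  refine (ae_eq_condExp_of_forall_setIntegral_eq (ℱ.le t) (run.integrable_comp t hg_int)
    (fun A _ _ => (run.integrable_comp t m_integrable).integrableOn) (fun A hA _ => ?_)
    m_measurable.aestronglyMeasurable).symm
  rw [run.setIntegral_comp t hA hg hg_int,
    run.setIntegral_comp t hA (fun _ => measurable_const) m_integrable]
  simp [m]

theorem IsRun.ae_exists_tendsto_sum (run : G.IsRun p β rule J₀ Pr ℱ X pol) {w : ℕ → Ω → ℝ}
    (hw : ∀ t, Measurable[ℱ t] (w t)) (hg : ∀ π, Measurable (g π))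
    (hg_int : ∀ π, Integrable (g π) (G.chainLaw p π))
    (hg_zero : ∀ π, ∫ x, g π x ∂G.chainLaw p π = 0) {B : ℝ}
    (hB : ∀ n ω, ∑ t ∈ Finset.range n, (w t ω * g (pol t ω) (X t ω)) ^ 2 ≤ B) :
    ∀ᵐ ω ∂Pr, ∃ L, Tendsto (fun n => ∑ t ∈ Finset.range n, w t ω * g (pol t ω) (X t ω))
      atTop (𝓝 L) := by
  have product_measurable : ∀ t, Measurable[ℱ (t + 1)] fun ω => w t ω * g (pol t ω) (X t ω) :=
    fun t => ((hw t).mono (ℱ.mono t.le_succ) le_rfl).mul (run.measurable_comp t hg)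
  have product_integrable : ∀ t, Integrable (fun ω => w t ω * g (pol t ω) (X t ω)) Pr := fun t =>
    .of_bound ((product_measurable t).mono (ℱ.le _) le_rfl).aestronglyMeasurable (√B)
      (.of_forall fun ω => Real.abs_le_sqrt <| (Finset.single_le_sum
        (f := fun s => (w s ω * g (pol s ω) (X s ω)) ^ 2) (fun s _ => sq_nonneg _)
        (Finset.self_mem_range_succ t)).trans (hB (t + 1) ω))
  refine ae_exists_tendsto_sum_of_condExp_eq_zero_of_sum_sq_le (ℱ := ℱ)
    (d := fun t ω => w t ω * g (pol t ω) (X t ω))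
    (fun t => (product_measurable t).stronglyMeasurable) (fun t => ?_) hB
  filter_upwards [condExp_mul_of_stronglyMeasurable_left (hw t).stronglyMeasurable
    (product_integrable t) (run.integrable_comp t hg_int), run.condExp_comp t hg hg_int]
    with ω h_mul h_comp
  refine h_mul.trans ?_
  rw [Pi.mul_apply, h_comp, hg_zero, mul_zero, Pi.zero_apply]

theorem IsRun.ae_exists_tendsto_sum_estimateError (run : G.IsRun p β rule J₀ Pr ℱ X pol)
    (h : G.IsShortestPath) (hβ : Summable fun t => β t ^ 2) (i : S) :
    ∀ᵐ ω ∂Pr, ∃ L, Tendsto (fun n => ∑ t ∈ Finset.range n,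
      activeStep β rule (fun s => X s ω) i t * estimateError h (pol t ω) i (X t ω))
      atTop (𝓝 L) := by
  obtain ⟨C, hC⟩ := exists_abs_estimateError_le h
  have activeStep_mul : ∀ t ω,
      activeStep β rule (fun s => X s ω) i t * estimateError h (pol t ω) i (X t ω) =
        stepSize β (fun s => X s ω) t i rule * estimateError h (pol t ω) i (X t ω) :=
    fun t ω => by
      unfold activeStep
      split_ifs with hi
      · rfl
      · rw [estimateError_eq_zero h _ hi, mul_zero, mul_zero]
  simp only [activeStep_mul]
  refine run.ae_exists_tendsto_sum (g := fun π => estimateError h π i)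
    (B := (∑' t, β t ^ 2) * C ^ 2) (fun t => run.measurable_stepSize t i)
    (fun π => measurable_estimateError h π i)
    (fun π => .of_bound (measurable_estimateError h π i).aestronglyMeasurable C
      (.of_forall (hC π i)))
    (integral_estimateError h p · i) fun n ω => ?_
  simp only [← activeStep_mul, mul_pow]
  calc ∑ t ∈ Finset.range n, activeStep β rule (fun s => X s ω) i t ^ 2 *
        estimateError h (pol t ω) i (X t ω) ^ 2
      ≤ ∑ t ∈ Finset.range n, activeStep β rule (fun s => X s ω) i t ^ 2 * C ^ 2 := by
        gcongr ∑ t ∈ _, _ * ?_ with t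
        exact sq_le_sq.2 ((hC _ _ _).trans (le_abs_self C))
    _ ≤ (∑' t, β t ^ 2) * C ^ 2 := by
        rw [← Finset.sum_mul]
        exact mul_le_mul_of_nonneg_right (sum_sq_activeStep_le hβ n) (sq_nonneg C)

theorem IsRun.ae_exists_tendsto_sum_indicator (run : G.IsRun p β rule J₀ Pr ℱ X pol)
    {b : ℕ → ℝ} (hb : Summable fun t => b t ^ 2) {B : Set (ℕ → S)} (hB : MeasurableSet B) :
    ∀ᵐ ω ∂Pr, ∃ L, Tendsto (fun n => ∑ t ∈ Finset.range n,
      b t * (B.indicator 1 (X t ω) - (G.chainLaw p (pol t ω)).real B)) atTop (𝓝 L) := by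
  have indicator_integrable : ∀ π, Integrable (B.indicator 1) (G.chainLaw p π) := fun π =>
    (integrable_const (1 : ℝ)).indicator hB
  refine run.ae_exists_tendsto_sum (w := fun t _ => b t)
    (g := fun π x => B.indicator 1 x - (G.chainLaw p π).real B) (B := ∑' t, b t ^ 2)
    (fun _ => measurable_const)
    (fun _ => (measurable_one.indicator hB).sub measurable_const)
    (fun π => (indicator_integrable π).sub (integrable_const _)) (fun π => ?_) fun n ω => ?_
  · rw [integral_sub (indicator_integrable π) (integrable_const _), integral_indicator_one hB]
    simp
  · refine (Finset.sum_le_sum fun t _ => ?_).trans (hb.sum_le_tsum _ fun t _ => sq_nonneg _)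
    rw [mul_pow]
    refine mul_le_of_le_one_right (sq_nonneg _) ((sq_le_one_iff_abs_le_one _).2 ?_)
    have real_nonneg : 0 ≤ (G.chainLaw p (pol t ω)).real B := measureReal_nonneg
    have real_le_one : (G.chainLaw p (pol t ω)).real B ≤ 1 := measureReal_le_one
    by_cases hX : X t ω ∈ B <;> simp only [hX, Set.indicator_of_mem, Set.indicator_of_notMem,
      not_false_eq_true, Pi.one_apply, abs_le] <;> constructor <;> linarith

open Classical in
theorem IsRun.ae_not_summable_visits (run : G.IsRun p β rule J₀ Pr ℱ X pol)
    (hreach : G.Reachable p) {b : ℕ → ℝ} (hb_nonneg : ∀ t, 0 ≤ b t) (hb : ¬ Summable b)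
    (hb_sq : Summable fun t => b t ^ 2) (i : S) :
    ∀ᵐ ω ∂Pr, ¬ Summable fun t => if ∃ k, X t ω k = i then b t else 0 := by
  -- There are finitely many policies, so the reach probabilities of `i` are bounded away from `0`.
  obtain ⟨π₀, reachProb_ge⟩ := Finite.exists_min fun π : G.JointPolicy => G.reachProb p π i
  filter_upwards [run.ae_exists_tendsto_sum_indicator hb_sq (measurableSet_visits i)]
    with ω ⟨L, hL⟩
  have sum_reachProb : Tendsto (fun n => ∑ t ∈ Finset.range n, b t * G.reachProb p (pol t ω) i)
      atTop atTop := by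
    refine tendsto_atTop_mono (fun n => ?_)
      (((not_summable_iff_tendsto_nat_atTop_of_nonneg hb_nonneg).1 hb).atTop_mul_const
        (hreach π₀ i))
    rw [Finset.sum_mul]
    exact Finset.sum_le_sum fun t _ => mul_le_mul_of_nonneg_left (reachProb_ge _) (hb_nonneg t)
  refine not_summable_of_tendsto_sum_sub sum_reachProb (hL.congr fun n => ?_)
  refine Finset.sum_congr rfl fun t _ => ?_
  simp only [Set.indicator_apply, Set.mem_ofPred_eq, Pi.one_apply, mul_sub, mul_ite, mul_one,
    mul_zero, reachProb]

theorem IsRun.ae_tendsto_iterate (run : G.IsRun p β rule J₀ Pr ℱ X pol)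
    (h : G.IsShortestPath) (hreach : G.Reachable p) (hβ_nonneg : ∀ t, 0 ≤ β t)
    (hβ : ¬ Summable β) (hβ_sq : Summable fun t => β t ^ 2) {J : S → ℝ}
    (hJ : G.negaminOp J = J) :
    ∀ᵐ ω ∂Pr, ∀ i, Tendsto
      (fun t => G.iterate β rule J₀ (fun s => X s ω) (fun s => pol s ω) t i)
      atTop (𝓝 (J i)) := by
  filter_upwards [run.ae_isAdmissible,
    ae_all_iff.2 (run.ae_not_summable_visits hreach hβ_nonneg hβ hβ_sq),
    ae_all_iff.2 (run.ae_exists_tendsto_sum_estimateError h hβ_sq)]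
    with ω hω_admissible hω_visits hω_error
  exact tendsto_iterate h hβ_nonneg hβ_sq hJ (fun t => run.greedy t ω) hω_admissible
    (fun i => not_summable_activeStep hβ_nonneg hβ (hω_visits i)) hω_error

end Run

end AlternatingGame

end

theorem mainTheorem3_general {S : Type u} [Fintype S] [MeasurableSpace S]
    [DiscreteMeasurableSpace S] (G : AlternatingGame.{u, v} S) (hssp : G.IsShortestPath) :
    ∃ Jstar : S → ℝ,
      G.IsValue Jstar ∧ G.minimaxOp Jstar = Jstar ∧
      (∀ J : S → ℝ, G.negaminOp J = J ↔ J = G.flip Jstar) ∧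
      G.flip (G.flip Jstar) = Jstar ∧
      ∀ (p : PMF S), G.Reachable p → ∀ β : ℕ → ℝ, (∀ t, 0 ≤ β t) → ¬ Summable β →
        (Summable fun t => β t ^ 2) → ∀ (rule : StepRule) (J₀ : S → ℝ) {Ω : Type z}
        {mΩ : MeasurableSpace Ω} (Pr : Measure Ω) [IsFiniteMeasure Pr] (ℱ : Filtration ℕ mΩ)
        (X : ℕ → Ω → ℕ → S) (pol : ℕ → Ω → G.JointPolicy), G.IsRun p β rule J₀ Pr ℱ X pol →
        (∀ᵐ ω ∂Pr, ∀ i, Tendsto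
          (fun t => G.iterate β rule J₀ (fun s => X s ω) (fun s => pol s ω) t i)
          atTop (𝓝 (G.flip Jstar i))) ∧
        (∀ᵐ ω ∂Pr, ∀ i, Tendsto
          (fun t => G.flip (G.iterate β rule J₀ (fun s => X s ω) (fun s => pol s ω) t) i)
          atTop (𝓝 (Jstar i))) := by
  obtain ⟨J', hJ', J'_unique⟩ := AlternatingGame.existsUnique_negaminOp_eq_self hssp
  have fixedPoint : G.negaminOp (G.flip (G.flip J')) = G.flip (G.flip J') := by
    rwa [G.flip_flip]
  refine ⟨G.flip J', AlternatingGame.isValue_of_negaminOp_flip_eq hssp fixedPoint,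
    AlternatingGame.minimaxOp_eq_self hssp fixedPoint, fun J => ?_, G.flip_flip _,
    fun p hreach β hβ_nonneg hβ_sum hβ_sq rule J₀ Ω mΩ Pr _ ℱ X pol run => ?_⟩
  · rw [G.flip_flip]
    exact ⟨J'_unique J, fun h => h ▸ hJ'⟩
  · have iterate_tendsto := run.ae_tendsto_iterate hssp hreach hβ_nonneg hβ_sum hβ_sq hJ'
    rw [G.flip_flip]
    refine ⟨iterate_tendsto, ?_⟩
    filter_upwards [iterate_tendsto] with ω hω i
    simp only [AlternatingGame.flip_apply]
    exact (hω i).const_mul _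

theorem mainTheorem3 {S : Type u} [Fintype S] [MeasurableSpace S] [DiscreteMeasurableSpace S]
    (G : AlternatingGame.{u, v} S) (p : PMF S)
    (hreach : G.Reachable p) (hcommon : G.CommonTransitions) (hssp : G.IsShortestPath)
    (β : ℕ → ℝ) (hβ_nonneg : ∀ t, 0 ≤ β t) (hβ_sum : ¬ Summable β)
    (hβ_sq : Summable fun t => β t ^ 2) :
    ∃ Jstar : S → ℝ,
      G.IsValue Jstar ∧ G.minimaxOp Jstar = Jstar ∧
      (∀ J : S → ℝ, G.negaminOp J = J ↔ J = G.flip Jstar) ∧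
      G.flip (G.flip Jstar) = Jstar ∧
      ∀ (rule : StepRule) (J₀ : S → ℝ) {Ω : Type z} {mΩ : MeasurableSpace Ω} (Pr : Measure Ω)
        [IsProbabilityMeasure Pr] (ℱ : Filtration ℕ mΩ) (X : ℕ → Ω → ℕ → S)
        (pol : ℕ → Ω → G.JointPolicy), G.IsRun p β rule J₀ Pr ℱ X pol →
        (∀ᵐ ω ∂Pr, ∀ i, Tendsto
          (fun t => G.iterate β rule J₀ (fun s => X s ω) (fun s => pol s ω) t i)
          atTop (𝓝 (G.flip Jstar i))) ∧
        (∀ᵐ ω ∂Pr, ∀ i, Tendsto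
          (fun t => G.flip (G.iterate β rule J₀ (fun s => X s ω) (fun s => pol s ω) t) i)
          atTop (𝓝 (Jstar i))) := by
  obtain ⟨Jstar, isValue, bellman, unique, flip_flip, converges⟩ := mainTheorem3_general G hssp
  exact ⟨Jstar, isValue, bellman, unique, flip_flip, fun rule J₀ _ _ Pr _ =>
    converges p hreach β hβ_nonneg hβ_sum hβ_sq rule J₀ Pr⟩
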